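/- **Tiles.** A tile is an axis-parallel unit square cut by its diagonals into four right triangles, decorated with coloured arrows as follows (the colours are red and green). (i) Each of the four sides carries an arrow with an arbitrary orientation and an arbitrary colour. (ii) Each of the four half-diagonals carries an arrow. Two collinear half-diagonals form the *axis*: the two arrows on it have the same colour (red or green) and the same direction, one entering and one leaving the centre of the square. The other two arrows both enter the centre and have different colours. (iii) The four triangles are coloured red and green so that, on going into the centre perpendicularly to the axis (from either end), one has a red triangle on the left and a green triangle on the right; thus the colours alternate around the centre. There are $4\cdot 2\cdot 2\cdot 4^4=4096$ tiles up to translation ($4$ directions of the axis, $2$ colours of the axis, $2$ ways to colour the other two half-diagonals, $4$ possibilities for each side); this set is closed under rotations by multiples of $90^\circ$. Tiles may be translated but not flipped. **Correct tilings.** A *correct tiling* is a set of (translated) tiles with pairwise disjoint interiors whose union is the whole plane and that satisfies the following local rules. 1. Tiles are attached only side-to-side, and a shared side carries the same colour and the same orientation in both tiles. 2. Adjacent triangles (triangles with a common side) have different colours. 3. The crossing at each vertex of a tile, that is, the set of all arrows entering or leaving this vertex, is legal. A crossing is legal if it consists of eight arrows on the eight rays from the vertex at angles that are multiples of $45^\circ$,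 as follows: two arrows on opposite rays, the axis of the crossing, have the same colour and the same direction, one entering and one leaving the vertex; the two arrows perpendicular to the axis enter the vertex and have different colours; the four remaining arrows, at $45^\circ$ to the axis, leave the vertex, and for each of the two arrows that enter the vertex perpendicularly to the axis, looking along this arrow, of the two outgoing arrows next to it the left one is red and the right one is green. **Theorem.** There is a correct tiling of the plane, and every correct tiling $T$ is non-periodic: there is no vector $a\neq 0$ with $T+a=T$. -/

import Mathlib

namespace SquareTiling

/-- The two colours, used both for arrows and for triangles. -/
inductive Color where
  | red
  | green

/-- The other colour. -/
def Color.other : Color → Color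
  | .red => .green
  | .green => .red

/-- The plane. -/
abbrev Plane : Type := ℝ × ℝ

/-- A coloured arrow in the plane. -/
structure Arrow where
  tail : Plane
  head : Plane
  color : Color

/-- The decoration of one side of a square tile: a colour and an orientation (`ccw = true` if the
arrow on the side runs counterclockwise around the tile, `ccw = false` if it runs clockwise). -/
structure SideLabel where
  ccw : Bool
  color : Color

/-- The decorated square tiles.

The corners of a square are numbered `0, 1, 2, 3` = NE, NW, SW, SE and its sides are numbered
`0, 1, 2, 3` = E, N, W, S, so that side `j` runs counterclockwise from corner `j - 1` to corner `j`;
indices are taken modulo 4. The two diagonals cut the square into four right triangles,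
triangle `j` being the one with hypotenuse side `j`.

Each tile carries an arrow on each of its four sides, arbitrarily oriented and coloured, and an
arrow on each of its four half-diagonals. Two collinear half-diagonals form the axis: it passes
through the centre, from corner `axis + 2` to corner `axis`, without changing direction or colour
(`axisColor`). The other two half-diagonals enter the centre and have different colours, that from
corner `axis + 1` having the colour `entryColor`. The four values of `axis` are the four rotations
of a tile. -/
structure Tile where
  axis : Fin 4
  axisColor : Color
  entryColor : Color
  side : Fin 4 → SideLabel

/-- The arrow on the half-diagonal to corner `j` goes from the centre to the corner only for
`j = axis`; the other three arrows enter the centre. -/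
def Tile.diagOutward (t : Tile) (j : Fin 4) : Bool := decide (j = t.axis)

/-- The colour of the arrow on the half-diagonal to corner `j`. -/
def Tile.diagColor (t : Tile) (j : Fin 4) : Color :=
  if j = t.axis ∨ j = t.axis + 2 then t.axisColor
  else if j = t.axis + 1 then t.entryColor
  else t.entryColor.other

/-- The colour of triangle `j` of a tile. On going into the centre perpendicularly to the axis
(from corner `axis + 1` or from corner `axis + 3`), one has a red triangle on the left
(`axis + 1`, respectively `axis + 3`) and a green one on the right (`axis + 2`, respectively
`axis`). So the colours alternate around the centre. -/
def Tile.triangleColor (t : Tile) (j : Fin 4) : Color :=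
  if j = t.axis + 1 ∨ j = t.axis + 3 then .red else .green

/-- Position of corner `j` of a unit square relative to the centre of the square. -/
noncomputable def cornerOffset : Fin 4 → Plane :=
  ![(1 / 2, 1 / 2), (-1 / 2, 1 / 2), (-1 / 2, -1 / 2), (1 / 2, -1 / 2)]

/-- A tile placed in the plane, as an axis-parallel unit square with the given centre. -/
structure PlacedTile where
  center : Plane
  tile : Tile

namespace PlacedTile

/-- The closed unit square occupied by a placed tile (`Set.Icc` in `ℝ × ℝ` is a rectangle). -/
def square (x : PlacedTile) : Set Plane :=
  Set.Icc (x.center - (1 / 2, 1 / 2)) (x.center + (1 / 2, 1 / 2))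

/-- The corner `j` of a placed tile. -/
noncomputable def corner (x : PlacedTile) (j : Fin 4) : Plane := x.center + cornerOffset j

/-- The side `j` of a placed tile, as a segment. -/
def sideSegment (x : PlacedTile) (j : Fin 4) : Set Plane :=
  segment ℝ (x.corner (j - 1)) (x.corner j)

/-- The arrow drawn on the side `j` of a placed tile. -/
noncomputable def sideArrow (x : PlacedTile) (j : Fin 4) : Arrow :=
  if (x.tile.side j).ccw then ⟨x.corner (j - 1), x.corner j, (x.tile.side j).color⟩
  else ⟨x.corner j, x.corner (j - 1), (x.tile.side j).color⟩

/-- The arrow drawn on the half-diagonal to corner `j` of a placed tile. -/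
noncomputable def diagArrow (x : PlacedTile) (j : Fin 4) : Arrow :=
  if x.tile.diagOutward j then ⟨x.center, x.corner j, x.tile.diagColor j⟩
  else ⟨x.corner j, x.center, x.tile.diagColor j⟩

/-- All eight arrows of a placed tile. -/
def arrows (x : PlacedTile) : Set Arrow := Set.range x.sideArrow ∪ Set.range x.diagArrow

end PlacedTile

/-- A tiling of the whole plane: a set of placed tiles with pairwise disjoint interiors whose
union is the plane. -/
structure IsTilingOfPlane (T : Set PlacedTile) : Prop where
  disjoint : ∀ x ∈ T, ∀ y ∈ T, x ≠ y → Disjoint (interior x.square) (interior y.square)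
  cover : ⋃ x ∈ T, x.square = Set.univ

/-- Tiles are attached only side-to-side: two tiles with more than one point in common meet
exactly in a common full side. -/
def SideToSide (T : Set PlacedTile) : Prop :=
  ∀ x ∈ T, ∀ y ∈ T, x ≠ y → (x.square ∩ y.square).Nontrivial →
    ∃ i j, x.square ∩ y.square = x.sideSegment i ∧ x.square ∩ y.square = y.sideSegment j

/-- Shared sides have matching colours and orientations: both tiles draw the same arrow there. -/
def SidesMatch (T : Set PlacedTile) : Prop :=
  ∀ x ∈ T, ∀ y ∈ T, ∀ i j, x.sideSegment i = y.sideSegment j → x.sideArrow i = y.sideArrow j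

/-- Adjacent triangles have different colours. (Adjacent triangles of one and the same tile always
do, so this concerns triangles of two tiles with a common side.) -/
def TrianglesAlternate (T : Set PlacedTile) : Prop :=
  ∀ x ∈ T, ∀ y ∈ T, x ≠ y → ∀ i j, x.sideSegment i = y.sideSegment j →
    x.tile.triangleColor i ≠ y.tile.triangleColor j

/-- The eight directions: `rayDir k` points in the direction of the angle `k * 45°`. -/
def rayDir : Fin 8 → Plane :=
  ![(1, 0), (1, 1), (0, 1), (-1, 1), (-1, 0), (-1, -1), (0, -1), (1, -1)]

/-- An arrow at a vertex, as seen from the vertex: it lies on the ray of angle `ray * 45°`, it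
leaves (`outgoing = true`) or enters (`outgoing = false`) the vertex, and it has a colour. -/
structure Prong where
  ray : Fin 8
  outgoing : Bool
  color : Color

/-- The arrow `a` has an endpoint at `v` and looks like `g` from there. -/
def Arrow.HasProng (a : Arrow) (v : Plane) (g : Prong) : Prop :=
  a.color = g.color ∧ ∃ r : ℝ, 0 < r ∧
    if g.outgoing then a.tail = v ∧ a.head = v + r • rayDir g.ray
    else a.head = v ∧ a.tail = v + r • rayDir g.ray

/-- The crossing centred at `v`: the arrows of the tiles that enter or leave `v`. -/
def crossing (T : Set PlacedTile) (v : Plane) : Set Prong :=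
  {g | ∃ x ∈ T, ∃ a ∈ x.arrows, a.HasProng v g}

/-- The legal crossing whose axis points in direction `k` (modulo 8) and has colour `c`. The two
arrows perpendicular to the axis enter the centre; that on ray `k + 2` has colour `e` and that on
ray `k + 6` has the other colour. The four remaining arrows leave the centre at an angle of `45°` to
the axis; next to each arrow that enters the centre perpendicularly to the axis, looking along
that arrow, there is a red one on the left and a green one on the right. -/
def legalCrossing (k : Fin 8) (c e : Color) : Set Prong :=
  {⟨k, true, c⟩, ⟨k + 4, false, c⟩, ⟨k + 2, false, e⟩, ⟨k + 6, false, e.other⟩,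
    ⟨k + 1, true, .red⟩, ⟨k + 3, true, .green⟩, ⟨k + 5, true, .red⟩, ⟨k + 7, true, .green⟩}

/-- All crossings at the vertices of the tiles are legal. -/
def CrossingsLegal (T : Set PlacedTile) : Prop :=
  ∀ x ∈ T, ∀ j, ∃ k c e, crossing T (x.corner j) = legalCrossing k c e

/-- Correct tilings of the plane by the decorated square tiles. -/
structure IsCorrectTiling (T : Set PlacedTile) : Prop where
  tiling : IsTilingOfPlane T
  sideToSide : SideToSide T
  sidesMatch : SidesMatch T
  trianglesAlternate : TrianglesAlternate T
  crossingsLegal : CrossingsLegal T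

/-- The translate of a set of placed tiles by a vector. -/
def translate (a : Plane) (T : Set PlacedTile) : Set PlacedTile :=
  (fun x => ⟨x.center + a, x.tile⟩) '' T

/-- A tiling is non-periodic if no nonzero vector is a period of it. -/
def IsNonPeriodic (T : Set PlacedTile) : Prop :=
  ∀ a : Plane, a ≠ 0 → translate a T ≠ T

end SquareTiling

/-!
A tiling by unit squares that meet side-to-side is a lattice tiling, so a correct tiling amounts to
arrows on the square lattice and its half-diagonals. It is convenient to treat the centres of the
tiles as crossings as well: by the rule on the colours of the triangles, the decoration of a tile
looks at its centre exactly like a legal crossing, if the colours of the triangles are read as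
colours of outgoing arrows. All points (vertices and centres) together form a square lattice turned
by 45 degrees, `ℤ × ℤ` in suitable coordinates, and a tiling becomes an assignment of crossings to
these points, with matching conditions along unit edges and diagonals (`IsGrid`).

*Non-periodicity.* Adjacent triangles have different colours, so the axes of adjacent tiles are
perpendicular (`IsGrid.exists_aligned`). Hence the axes form a lattice of squares of side `√2`.
At a vertex inside such a square all four half-diagonals leave the vertex, so by legality its own
axis lies along the sides of the tiles: the crossing is the centre of a tile of side `√2`, with the
old half-diagonals giving the colours of its triangles. So a correct tiling is composed into a
correct tiling by larger tiles (`IsAlignedGrid.compose`); in coordinates this is division by `1 + i`.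
A period must preserve the directions of the axes, hence is a period of the composed tiling as well,
and is therefore divisible by all powers of `1 + i` (`IsGrid.period_eq_zero`).

*Existence.* Composition has an inverse, `decompose`, which makes sense even when the vertices are
not legal. The new vertices are the old vertices, with unchanged crossings, and the old centres,
which are legal. Starting from a grid whose vertices need not be legal, after `n` decompositions
illegal crossings are found only at multiples of `(1 + i) ^ n`; a limit of translates has legal
crossings everywhere (`exists_legal_grid`).
-/

namespace SquareTiling

/-! ### Marks and crossings -/

instance : DecidableEq Color
  | .red, .red => isTrue rfl
  | .green, .green => isTrue rfl
  | .red, .green => isFalse (fun h => by cases h)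
  | .green, .red => isFalse (fun h => by cases h)

instance : Fintype Color := ⟨{.red, .green}, fun c => by cases c <;> decide⟩

/-- An arrow end seen from a point on a known ray: whether the arrow leaves the point, and its
colour. -/
abbrev Mark : Type := Bool × Color

/-- The same arrow seen from its other end. -/
def Mark.flip (m : Mark) : Mark := (!m.1, m.2)

/-- The marks of the legal crossing with axis `k`, axis colour `c` and entry colour `e`, as a
function of the ray. -/
def legalMarks (k : Fin 8) (c e : Color) (r : Fin 8) : Mark :=
  ![(true, c), (true, .red), (false, e), (true, .green), (false, c), (true, .red),
    (false, e.other), (true, .green)] (r - k)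

theorem legalMarks_add_one (k : Fin 8) (c e : Color) (r : Fin 8) :
    legalMarks k c e (r + 1) = legalMarks (k - 1) c e r := by
  unfold legalMarks
  congr 1
  revert r k; decide

theorem legalMarks_sub_one (k : Fin 8) (c e : Color) (r : Fin 8) :
    legalMarks k c e (r - 1) = legalMarks (k + 1) c e r := by
  unfold legalMarks
  congr 1
  revert r k; decide

theorem mem_legalCrossing (k : Fin 8) (c e : Color) (g : Prong) :
    g ∈ legalCrossing k c e ↔ legalMarks k c e g.ray = (g.outgoing, g.color) := by
  obtain ⟨r, o, d⟩ := g
  obtain ⟨s, rfl⟩ : ∃ s, r = k + s := ⟨r - k, by simp⟩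
  have h0 : ∀ s : Fin 8, k + s - k = s := fun s => by simp
  have h1 : ∀ s : Fin 8, (k + s = k ↔ s = 0) := fun s => by simp
  simp only [legalCrossing, Set.mem_insert_iff, Set.mem_singleton_iff, legalMarks, h0,
    Prong.mk.injEq, h1, add_right_inj]
  fin_cases s <;> simp [eq_comm]

theorem legalMarks_horizontal_ne_vertical {k k' : Fin 8} {c e c' e' : Color}
    (hk : k = 0 ∨ k = 4) (hk' : k' = 2 ∨ k' = 6) : legalMarks k c e ≠ legalMarks k' c' e' := by
  intro h
  have := congrFun h 1
  rcases hk with rfl | rfl <;> rcases hk' with rfl | rfl <;> revert this <;>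
    simp [legalMarks]

/-! ### Grids of crossings -/

/-- A grid of marks, at the points of `ℤ × ℤ`. The points with even coordinate sum stand for
tile vertices, the other points for tile centres; neighbouring points are joined by half-diagonals
and diagonal neighbours among the vertices by sides. The coordinate axes of the grid are thus
the diagonal directions of the plane, ray `r` of the grid being ray `r + 1` of the plane.

A centre is treated as a crossing too, the marks on its odd rays being the colours of the
triangles. Vertices need not be legal. -/
structure IsGrid (X : ℤ → ℤ → Fin 8 → Mark) : Prop where
  center : ∀ x y, Odd (x + y) → ∃ k c e, k.val % 2 = 0 ∧ X x y = legalMarks k c e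
  east : ∀ x y, X (x + 1) y 4 = (X x y 0).flip
  north : ∀ x y, X x (y + 1) 6 = (X x y 2).flip
  northeast : ∀ x y, Even (x + y) → X (x + 1) (y + 1) 5 = (X x y 1).flip
  northwest : ∀ x y, Even (x + y) → X (x - 1) (y + 1) 7 = (X x y 3).flip
  triangle_ne : ∀ x y, Odd (x + y) → (X x y 1).2 ≠ (X (x + 1) (y + 1) 5).2
  triangle_nw : ∀ x y, Odd (x + y) → (X x y 3).2 ≠ (X (x - 1) (y + 1) 7).2

/-- A grid in which the axes of the centres `(x, y)` with `y` even are parallel to the first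
coordinate axis and those of the others to the second one; the triangle condition then holds
automatically. -/
structure IsAlignedGrid (X : ℤ → ℤ → Fin 8 → Mark) : Prop where
  horizontal : ∀ x y, Odd x → Even y → ∃ k c e, (k = 0 ∨ k = 4) ∧ X x y = legalMarks k c e
  vertical : ∀ x y, Even x → Odd y → ∃ k c e, (k = 2 ∨ k = 6) ∧ X x y = legalMarks k c e
  east : ∀ x y, X (x + 1) y 4 = (X x y 0).flip
  north : ∀ x y, X x (y + 1) 6 = (X x y 2).flip
  northeast : ∀ x y, Even (x + y) → X (x + 1) (y + 1) 5 = (X x y 1).flip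
  northwest : ∀ x y, Even (x + y) → X (x - 1) (y + 1) 7 = (X x y 3).flip

/-- The marks at a point form a legal crossing. -/
def IsLegal (m : Fin 8 → Mark) : Prop := ∃ k c e, m = legalMarks k c e

/-- All vertices of the grid are legal. -/
def LegalVertices (X : ℤ → ℤ → Fin 8 → Mark) : Prop :=
  ∀ x y, Even (x + y) → IsLegal (X x y)

theorem eq_iff_even_of_alternating {F : ℤ → Color} (h : ∀ a, F a ≠ F (a + 1)) (a : ℤ) :
    F a = F 0 ↔ Even a := by
  have key : ∀ p q r : Color, p ≠ q → ((p = r) ↔ ¬ (q = r)) := by decide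
  induction a using Int.induction_on with
  | zero => simp
  | succ i ih =>
    have ih : F i = F 0 ↔ Even (i : ℤ) := ih
    rw [Int.even_add_one, ← ih, key _ _ _ (h i).symm]
  | pred i ih =>
    have ih : F (-i) = F 0 ↔ Even (-i : ℤ) := ih
    have h1 := h (-(i : ℤ) - 1)
    rw [sub_add_cancel] at h1
    rw [Int.even_sub_one, ← ih, key _ _ _ h1]

/-- A grid becomes aligned after a suitable translation: the triangle condition makes the
directions of the axes of adjacent tiles alternate. -/
theorem IsGrid.exists_aligned {X : ℤ → ℤ → Fin 8 → Mark} (h : IsGrid X) :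
    ∃ t : ℤ, IsAlignedGrid fun x y => X (x + t) (y + t) := by
  have hcol : ∀ x y, Odd (x + y) → (X x y 5).2 = (X x y 1).2 ∧
      (X x y 3).2 = (X x y 1).2.other ∧ (X x y 7).2 = (X x y 1).2.other := by
    intro x y hxy
    obtain ⟨k, c, e, hk, hX⟩ := h.center x y hxy
    rw [hX]
    clear hX
    revert k c e
    decide
  have hne : ∀ x y, Odd (x + y) → (X x y 1).2 ≠ (X (x + 1) (y + 1) 1).2 := by
    intro x y hxy
    rw [← (hcol (x + 1) (y + 1) (by grind)).1]
    exact h.triangle_ne x y hxy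
  have hnw : ∀ x y, Odd (x + y) → (X x y 1).2 ≠ (X (x - 1) (y + 1) 1).2 := by
    intro x y hxy h1
    apply h.triangle_nw x y hxy
    rw [(hcol x y hxy).2.1, (hcol (x - 1) (y + 1) (by grind)).2.2, h1]
  have hall : ∀ x y, Odd (x + y) → ((X x y 1).2 = (X 1 0 1).2 ↔ Even y) := by
    intro x y hxy
    obtain ⟨b, hb⟩ : ∃ b, y = x - 1 + 2 * b := by
      obtain ⟨n, hn⟩ := hxy
      exact ⟨n - x + 1, by omega⟩
    have e1 := eq_iff_even_of_alternating (F := fun a => (X (1 + a) a 1).2)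
      (fun a => by
        have := hne (1 + a) a (by grind)
        rwa [add_assoc] at this) (x - 1 + b)
    have e2 := eq_iff_even_of_alternating
      (F := fun a => (X (1 + (x - 1 + b) - a) (x - 1 + b + a) 1).2)
      (fun a => by
        have := hnw (1 + (x - 1 + b) - a) (x - 1 + b + a) (by grind)
        rwa [sub_sub, add_assoc (x - 1 + b)] at this) b
    simp only [add_zero, sub_zero] at e1 e2
    have hx : 1 + (x - 1 + b) - b = x := by ring
    have hy : x - 1 + b + b = y := by rw [hb]; ring
    rw [hx, hy] at e2
    have key : ∀ p q r : Color, p = r ↔ ((p = q) ↔ (q = r)) := by decide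
    rw [key _ _ _, e1, e2, hb]
    grind
  obtain ⟨t, ht⟩ : ∃ t : ℤ, ∀ x y, Odd (x + y) → ((X (x + t) (y + t) 1).2 = .red ↔ Even y) := by
    by_cases hr : (X 1 0 1).2 = .red
    · refine ⟨0, fun x y hxy => ?_⟩
      rw [← hr]
      simpa using hall x y hxy
    · refine ⟨1, fun x y hxy => ?_⟩
      have key : ∀ p q : Color, ¬ q = .red → (p = .red ↔ ¬ p = q) := by decide
      rw [key _ _ hr, hall _ _ (by grind)]
      grind
  have hk : ∀ (k : Fin 8) (c e : Color), k.val % 2 = 0 →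
      (((legalMarks k c e 1).2 = .red → k = 0 ∨ k = 4) ∧
      (¬ (legalMarks k c e 1).2 = .red → k = 2 ∨ k = 6)) := by decide
  refine ⟨t, ⟨fun x y hx hy => ?_, fun x y hx hy => ?_, fun x y => ?_, fun x y => ?_,
    fun x y hxy => ?_, fun x y hxy => ?_⟩⟩
  · obtain ⟨k, c, e, hk2, hX⟩ := h.center (x + t) (y + t) (by grind)
    refine ⟨k, c, e, (hk k c e hk2).1 ?_, hX⟩
    rw [← hX, ht _ _ (by grind)]
    exact hy
  · obtain ⟨k, c, e, hk2, hX⟩ := h.center (x + t) (y + t) (by grind)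
    refine ⟨k, c, e, (hk k c e hk2).2 ?_, hX⟩
    rw [← hX, ht _ _ (by grind)]
    grind
  · simpa only [add_right_comm] using h.east (x + t) (y + t)
  · simpa only [add_right_comm] using h.north (x + t) (y + t)
  · simpa only [add_right_comm] using h.northeast (x + t) (y + t) (by grind)
  · have := h.northwest (x + t) (y + t) (by grind)
    rwa [add_sub_right_comm, add_right_comm y] at this

/-! ### Composition and non-periodicity -/

/-- The composition of a grid: the triangles are merged in pairs along the half-diagonals that are
not on an axis, so that the axes become the sides of tiles `√2` times as large. In coordinates,
the vertices of the grid are divided by `1 + i`. -/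
def compose (X : ℤ → ℤ → Fin 8 → Mark) (x y : ℤ) (r : Fin 8) : Mark :=
  X (x - y) (x + y) (r + 1)

/-- At a centre the axis passes straight through, whereas the two arrows perpendicular to it
come in with different colours. -/
theorem legalMarks_horizontal {k : Fin 8} (hk : k = 0 ∨ k = 4) (c e : Color) :
    legalMarks k c e 0 = (legalMarks k c e 4).flip ∧ (legalMarks k c e 2).1 = false ∧
      (legalMarks k c e 6).1 = false ∧ (legalMarks k c e 2).2 ≠ (legalMarks k c e 6).2 := by
  revert c e k; decide

theorem legalMarks_vertical {k : Fin 8} (hk : k = 2 ∨ k = 6) (c e : Color) :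
    legalMarks k c e 2 = (legalMarks k c e 6).flip ∧ (legalMarks k c e 0).1 = false ∧
      (legalMarks k c e 4).1 = false ∧ (legalMarks k c e 0).2 ≠ (legalMarks k c e 4).2 := by
  revert c e k; decide

@[simp] theorem Mark.flip_flip (m : Mark) : m.flip.flip = m := by simp [Mark.flip]

theorem LegalVertices.compose {X : ℤ → ℤ → Fin 8 → Mark} (h : LegalVertices X) (x y : ℤ) :
    IsLegal (compose X x y) := by
  obtain ⟨k, c, e, hX⟩ := h (x - y) (x + y) (by grind)
  exact ⟨k - 1, c, e, funext fun r => by simp only [SquareTiling.compose, hX, legalMarks_add_one]⟩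

theorem IsAlignedGrid.compose {X : ℤ → ℤ → Fin 8 → Mark} (h : IsAlignedGrid X)
    (hl : LegalVertices X) : IsGrid (compose X) := by
  refine ⟨fun x y hxy => ?_, fun x y => ?_, fun x y => ?_, fun x y hxy => ?_, fun x y hxy => ?_,
    fun x y hxy => ?_, fun x y hxy => ?_⟩
  · obtain ⟨k, c, e, hX⟩ := hl.compose x y
    refine ⟨k, c, e, ?_, hX⟩
    -- All four axes of the tiles around the vertex avoid it, so the four half-diagonals leave it.
    set u := x - y with hu
    set v := x + y with hv
    have a0 : (SquareTiling.compose X x y 7).1 = true := by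
      have := h.east u v
      obtain ⟨k, c, e, hk, hX⟩ := h.vertical (u + 1) v (by grind) (by grind)
      have h2 := (legalMarks_vertical hk c e).2.2.1
      rw [← hX, this] at h2
      change (X u v 0).1 = true
      simpa [Mark.flip] using h2
    have a4 : (SquareTiling.compose X x y 3).1 = true := by
      have := h.east (u - 1) v
      obtain ⟨k, c, e, hk, hX⟩ := h.vertical (u - 1) v (by grind) (by grind)
      have h2 := (legalMarks_vertical hk c e).2.1
      rw [sub_add_cancel] at this
      change (X u v 4).1 = true
      rw [this, hX]
      simp [Mark.flip, h2]
    have a2 : (SquareTiling.compose X x y 1).1 = true := by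
      have := h.north u v
      obtain ⟨k, c, e, hk, hX⟩ := h.horizontal u (v + 1) (by grind) (by grind)
      have h2 := (legalMarks_horizontal hk c e).2.2.1
      rw [← hX, this] at h2
      change (X u v 2).1 = true
      simpa [Mark.flip] using h2
    have a6 : (SquareTiling.compose X x y 5).1 = true := by
      have := h.north u (v - 1)
      obtain ⟨k, c, e, hk, hX⟩ := h.horizontal u (v - 1) (by grind) (by grind)
      have h2 := (legalMarks_horizontal hk c e).2.1
      rw [sub_add_cancel] at this
      change (X u v 6).1 = true
      rw [this, hX]
      simp [Mark.flip, h2]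
    rw [hX] at a0 a2 a4 a6
    revert k c e
    clear hu hv
    intro k c e _
    clear * -
    revert k c e
    decide
  · have := h.northeast (x - y) (x + y) (by grind)
    rw [sub_add_eq_add_sub, add_right_comm] at this
    exact this
  · have := h.northwest (x - y) (x + y) (by grind)
    rw [sub_sub, add_assoc] at this
    exact this
  · have h1 := h.north (x - y) (x + y)
    have h2 := h.north (x - y) (x + y + 1)
    obtain ⟨k, c, e, hk, hX⟩ := h.vertical (x - y) (x + y + 1) (by grind) (by grind)
    have h3 := (legalMarks_vertical hk c e).1
    rw [← hX, h1, Mark.flip_flip] at h3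
    have e1 : x + 1 - (y + 1) = x - y := by ring
    have e2 : x + 1 + (y + 1) = x + y + 1 + 1 := by ring
    change X (x + 1 - (y + 1)) (x + 1 + (y + 1)) 6 = (X (x - y) (x + y) 2).flip
    rw [e1, e2, h2, h3]
  · have h1 := h.east (x - y - 1) (x + y)
    have h2 := h.east (x - y - 1 - 1) (x + y)
    obtain ⟨k, c, e, hk, hX⟩ := h.horizontal (x - y - 1) (x + y) (by grind) (by grind)
    have h3 := (legalMarks_horizontal hk c e).1
    rw [sub_add_cancel] at h1 h2
    rw [← hX, h2, Mark.flip_flip] at h3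
    have e1 : x - 1 - (y + 1) = x - y - 1 - 1 := by ring
    have e2 : x - 1 + (y + 1) = x + y := by ring
    change X (x - 1 - (y + 1)) (x - 1 + (y + 1)) 0 = (X (x - y) (x + y) 4).flip
    rw [e1, e2, h1, h3, Mark.flip_flip]
  · have h1 := h.north (x - y) (x + y)
    have h2 := h.north (x - y) (x + y + 1)
    obtain ⟨k, c, e, hk, hX⟩ := h.horizontal (x - y) (x + y + 1) (by grind) (by grind)
    have h3 := (legalMarks_horizontal hk c e).2.2.2
    rw [← hX, h1] at h3
    have e1 : x + 1 - (y + 1) = x - y := by ring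
    have e2 : x + 1 + (y + 1) = x + y + 1 + 1 := by ring
    change (X (x - y) (x + y) 2).2 ≠ (X (x + 1 - (y + 1)) (x + 1 + (y + 1)) 6).2
    rw [e1, e2, h2]
    exact h3.symm
  · have h1 := h.east (x - y - 1) (x + y)
    have h2 := h.east (x - y - 1 - 1) (x + y)
    obtain ⟨k, c, e, hk, hX⟩ := h.vertical (x - y - 1) (x + y) (by grind) (by grind)
    have h3 := (legalMarks_vertical hk c e).2.2.2
    rw [sub_add_cancel] at h1 h2
    rw [← hX, h2] at h3
    have e1 : x - 1 - (y + 1) = x - y - 1 - 1 := by ring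
    have e2 : x - 1 + (y + 1) = x + y := by ring
    change (X (x - y) (x + y) 4).2 ≠ (X (x - 1 - (y + 1)) (x - 1 + (y + 1)) 0).2
    rw [e1, e2, h1]
    exact h3

/-- Descent: an even period of a grid with legal vertices, divided by `1 + i`, is an even period
of the composed grid. -/
theorem IsGrid.period_eq_zero {X : ℤ → ℤ → Fin 8 → Mark} (h : IsGrid X) (hl : LegalVertices X)
    {a b : ℤ} (hab : Even (a + b)) (hp : ∀ x y, X (x + a) (y + b) = X x y) : a = 0 ∧ b = 0 := by
  obtain ⟨n, hn⟩ : ∃ n : ℕ, a ^ 2 + b ^ 2 ≤ n := ⟨(a ^ 2 + b ^ 2).toNat, by simp⟩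
  induction n using Nat.strong_induction_on generalizing X a b with
  | _ n ih =>
    by_contra hne
    have hpos : 0 < a ^ 2 + b ^ 2 := by
      by_contra h0
      exact hne ⟨by nlinarith [sq_nonneg a, sq_nonneg b], by nlinarith [sq_nonneg a, sq_nonneg b]⟩
    obtain ⟨t, ht⟩ := h.exists_aligned
    have hb : Even b := by
      by_contra hb
      rw [Int.not_even_iff_odd] at hb
      obtain ⟨k, c, e, hk, hX⟩ := ht.horizontal 1 0 (by simp) (by simp)
      obtain ⟨k', c', e', hk', hX'⟩ := ht.vertical (1 + a) b (by grind) hb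
      apply legalMarks_horizontal_ne_vertical hk hk' (c := c) (e := e) (c' := c') (e' := e')
      rw [← hX, ← hX', ← hp]
      congr 1 <;> ring
    obtain ⟨d, hd⟩ := hb
    obtain ⟨s, hs⟩ := hab
    have hlt : LegalVertices fun x y => X (x + t) (y + t) :=
      fun x y hxy => hl _ _ (by grind)
    have hm : s ^ 2 + (b - s) ^ 2 < n := by
      have : 2 * (s ^ 2 + (b - s) ^ 2) = a ^ 2 + b ^ 2 := by
        have : a = 2 * s - b := by omega
        subst this; ring
      nlinarith
    obtain ⟨m, hm'⟩ : ∃ m : ℕ, s ^ 2 + (b - s) ^ 2 = m :=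
      ⟨_, (Int.toNat_of_nonneg (by positivity)).symm⟩
    have := ih m (by exact_mod_cast hm' ▸ hm) (ht.compose hlt) (fun x y _ => hlt.compose x y)
      (a := s) (b := b - s) ⟨d, by omega⟩ (fun x y => funext fun r => by
        have := congrFun (hp (x - y + t) (x + y + t)) (r + 1)
        simp only [SquareTiling.compose]
        rw [← this]
        congr 1 <;> grind) hm'.le
    exact hne ⟨by lia, by lia⟩

/-! ### Decomposition and existence of grids with legal vertices -/

/-- The decomposition of an aligned grid, inverse to `compose`: the points of the grid, multiplied
by `1 + i`, become the vertices, and the midpoints of the sides become the centres. The axis of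
such a centre is the old side. The other two arrows come from the centres of the old tiles and
inherit the colours of the old triangles. -/
def decompose (X : ℤ → ℤ → Fin 8 → Mark) (x y : ℤ) : Fin 8 → Mark :=
  if Even (x + y) then fun r => X ((x + y) / 2) ((y - x) / 2) (r - 1)
  else if Even y then
    let s := X ((x + y - 1) / 2) ((y - x + 1) / 2) 7
    if s.1 then legalMarks 0 s.2 (X ((x + y + 1) / 2) ((y - x + 1) / 2) 5).2
    else legalMarks 4 s.2 (X ((x + y - 1) / 2) ((y - x - 1) / 2) 1).2
  else
    let s := X ((x + y - 1) / 2) ((y - x - 1) / 2) 1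
    if s.1 then legalMarks 2 s.2 (X ((x + y - 1) / 2) ((y - x + 1) / 2) 7).2
    else legalMarks 6 s.2 (X ((x + y + 1) / 2) ((y - x - 1) / 2) 3).2

theorem decompose_even (X : ℤ → ℤ → Fin 8 → Mark) {x y a b : ℤ} (hx : x = a - b)
    (hy : y = a + b) (r : Fin 8) : decompose X x y r = X a b (r - 1) := by
  have h1 : Even (x + y) := ⟨a, by omega⟩
  have h2 : (x + y) / 2 = a := by omega
  have h3 : (y - x) / 2 = b := by omega
  simp [decompose, h1, h2, h3]

theorem decompose_horizontal (X : ℤ → ℤ → Fin 8 → Mark) {x y a b : ℤ} (hx : x = a - b + 1)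
    (hy : y = a + b) (he : Even y) :
    decompose X x y = if (X a b 7).1 then legalMarks 0 (X a b 7).2 (X (a + 1) b 5).2
      else legalMarks 4 (X a b 7).2 (X a (b - 1) 1).2 := by
  have h1 : ¬ Even (x + y) := by grind
  have h2 : (x + y - 1) / 2 = a := by omega
  have h3 : (x + y + 1) / 2 = a + 1 := by omega
  have h4 : (y - x + 1) / 2 = b := by omega
  have h5 : (y - x - 1) / 2 = b - 1 := by omega
  simp [decompose, h1, h2, h3, h4, h5, he]

theorem decompose_vertical (X : ℤ → ℤ → Fin 8 → Mark) {x y a b : ℤ} (hx : x = a - b)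
    (hy : y = a + b + 1) (ho : Odd y) :
    decompose X x y = if (X a b 1).1 then legalMarks 2 (X a b 1).2 (X a (b + 1) 7).2
      else legalMarks 6 (X a b 1).2 (X (a + 1) b 3).2 := by
  have h1 : ¬ Even (x + y) := by grind
  have h2 : (x + y - 1) / 2 = a := by omega
  have h3 : (x + y + 1) / 2 = a + 1 := by omega
  have h4 : (y - x + 1) / 2 = b + 1 := by omega
  have h5 : (y - x - 1) / 2 = b := by omega
  have he : ¬ Even y := by grind
  simp [decompose, h1, h2, h3, h4, h5, he]

theorem legalMarks_horizontal_odd {k : Fin 8} (hk : k = 0 ∨ k = 4) (c e : Color) :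
    legalMarks k c e 1 = (true, .red) ∧ legalMarks k c e 3 = (true, .green) ∧
      legalMarks k c e 5 = (true, .red) ∧ legalMarks k c e 7 = (true, .green) := by
  revert c e k; decide

theorem legalMarks_vertical_odd {k : Fin 8} (hk : k = 2 ∨ k = 6) (c e : Color) :
    legalMarks k c e 1 = (true, .green) ∧ legalMarks k c e 3 = (true, .red) ∧
      legalMarks k c e 5 = (true, .green) ∧ legalMarks k c e 7 = (true, .red) := by
  revert c e k; decide

/-- The marks on the even rays of a centre obtained by decomposition from a side with marks `s`. -/
theorem decomposed_center_marks (k : Fin 8) (s : Mark) (e e' : Color) (h : e ≠ e') :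
    (if s.1 then legalMarks k s.2 e else legalMarks (k + 4) s.2 e') k = s ∧
    (if s.1 then legalMarks k s.2 e else legalMarks (k + 4) s.2 e') (k + 4) = s.flip ∧
    (if s.1 then legalMarks k s.2 e else legalMarks (k + 4) s.2 e') (k + 2) = (false, e) ∧
    (if s.1 then legalMarks k s.2 e else legalMarks (k + 4) s.2 e') (k + 6) = (false, e') := by
  obtain ⟨o, c⟩ := s
  revert k o c e e'
  decide

/-- Every point of `ℤ × ℤ` is an old point, or the midpoint of an old side of one of the two
directions. -/
theorem point_cases (x y : ℤ) :
    (∃ a b, x = a - b ∧ y = a + b) ∨ (∃ a b, x = a - b + 1 ∧ y = a + b ∧ Even y) ∨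
      ∃ a b, x = a - b ∧ y = a + b + 1 ∧ Odd y := by
  rcases Int.even_or_odd (x + y) with ⟨s, hs⟩ | ⟨s, hs⟩
  · exact .inl ⟨s, y - s, by omega, by omega⟩
  · rcases Int.even_or_odd y with hy | hy
    · exact .inr (.inl ⟨s, y - s, by omega, by omega, hy⟩)
    · exact .inr (.inr ⟨s, y - s - 1, by omega, by omega, hy⟩)

theorem isLegal_decompose {X : ℤ → ℤ → Fin 8 → Mark} {a b : ℤ} (hl : IsLegal (X a b)) :
    IsLegal (decompose X (a - b) (a + b)) := by
  obtain ⟨k, c, e, hX⟩ := hl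
  exact ⟨k + 1, c, e, funext fun r => by
    rw [decompose_even X rfl rfl, hX, legalMarks_sub_one]⟩

namespace IsAlignedGrid

variable {X : ℤ → ℤ → Fin 8 → Mark}

theorem marks_horizontal (h : IsAlignedGrid X) {x y : ℤ} (hx : Odd x) (hy : Even y) :
    X x y 1 = (true, .red) ∧ X x y 3 = (true, .green) ∧ X x y 5 = (true, .red) ∧
      X x y 7 = (true, .green) := by
  obtain ⟨k, c, e, hk, hX⟩ := h.horizontal x y hx hy
  rw [hX]
  exact legalMarks_horizontal_odd hk c e

theorem marks_vertical (h : IsAlignedGrid X) {x y : ℤ} (hx : Even x) (hy : Odd y) :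
    X x y 1 = (true, .green) ∧ X x y 3 = (true, .red) ∧ X x y 5 = (true, .green) ∧
      X x y 7 = (true, .red) := by
  obtain ⟨k, c, e, hk, hX⟩ := h.vertical x y hx hy
  rw [hX]
  exact legalMarks_vertical_odd hk c e

theorem decompose_horizontal_marks (h : IsAlignedGrid X) {x y a b : ℤ} (hx : x = a - b + 1) (hy : y = a + b)
    (he : Even y) : decompose X x y 0 = X a b 7 ∧ decompose X x y 4 = (X a b 7).flip ∧
      decompose X x y 2 = (X (a + 1) b 5).flip ∧ decompose X x y 6 = (X a (b - 1) 1).flip := by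
  rw [decompose_horizontal X hx hy he]
  rcases Int.even_or_odd a with ha | ha
  · have h1 := (h.marks_horizontal (x := a + 1) (y := b) (by grind) (by grind)).2.2.1
    have h2 := (h.marks_vertical (x := a) (y := b - 1) (by grind) (by grind)).1
    rw [h1, h2]
    exact decomposed_center_marks 0 _ _ _ (by decide)
  · have h1 := (h.marks_vertical (x := a + 1) (y := b) (by grind) (by grind)).2.2.1
    have h2 := (h.marks_horizontal (x := a) (y := b - 1) (by grind) (by grind)).1
    rw [h1, h2]
    exact decomposed_center_marks 0 _ _ _ (by decide)

theorem decompose_vertical_marks (h : IsAlignedGrid X) {x y a b : ℤ} (hx : x = a - b) (hy : y = a + b + 1)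
    (ho : Odd y) : decompose X x y 2 = X a b 1 ∧ decompose X x y 6 = (X a b 1).flip ∧
      decompose X x y 4 = (X a (b + 1) 7).flip ∧ decompose X x y 0 = (X (a + 1) b 3).flip := by
  rw [decompose_vertical X hx hy ho]
  rcases Int.even_or_odd a with ha | ha
  · have h1 := (h.marks_vertical (x := a) (y := b + 1) (by grind) (by grind)).2.2.2
    have h2 := (h.marks_horizontal (x := a + 1) (y := b) (by grind) (by grind)).2.1
    rw [h1, h2]
    exact decomposed_center_marks 2 _ _ _ (by decide)
  · have h1 := (h.marks_horizontal (x := a) (y := b + 1) (by grind) (by grind)).2.2.2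
    have h2 := (h.marks_vertical (x := a + 1) (y := b) (by grind) (by grind)).2.1
    rw [h1, h2]
    exact decomposed_center_marks 2 _ _ _ (by decide)

protected theorem decompose (h : IsAlignedGrid X) : IsAlignedGrid (decompose X) := by
  refine ⟨fun x y hx hy => ?_, fun x y hx hy => ?_, fun x y => ?_, fun x y => ?_,
    fun x y hxy => ?_, fun x y hxy => ?_⟩
  · obtain ⟨s, hs⟩ : Odd (x + y) := by grind
    rw [decompose_horizontal X (a := s) (b := y - s) (by omega) (by omega) hy]
    split_ifs
    · exact ⟨_, _, _, .inl rfl, rfl⟩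
    · exact ⟨_, _, _, .inr rfl, rfl⟩
  · obtain ⟨s, hs⟩ : Odd (x + y) := by grind
    rw [decompose_vertical X (a := s) (b := y - s - 1) (by omega) (by omega) hy]
    split_ifs
    · exact ⟨_, _, _, .inl rfl, rfl⟩
    · exact ⟨_, _, _, .inr rfl, rfl⟩
  · rcases point_cases x y with ⟨a, b, hx, hy⟩ | ⟨a, b, hx, hy, hp⟩ | ⟨a, b, hx, hy, hp⟩
    · rw [decompose_even X hx hy]
      rcases Int.even_or_odd y with hp | hp
      · exact (h.decompose_horizontal_marks (x := x + 1) (by omega) hy hp).2.1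
      · have := (h.decompose_vertical_marks (x := x + 1) (a := a) (b := b - 1) (by omega)
          (by omega) hp).2.2.1
        rwa [sub_add_cancel] at this
    · rw [decompose_even X (a := a + 1) (b := b - 1) (by omega) (by omega),
        (h.decompose_horizontal_marks hx hy hp).1]
      have := h.northwest (a + 1) (b - 1) (by grind)
      rw [add_sub_cancel_right, sub_add_cancel] at this
      rw [this, Mark.flip_flip]
      rfl
    · rw [decompose_even X (a := a + 1) (b := b) (by omega) (by omega),
        (h.decompose_vertical_marks hx hy hp).2.2.2, Mark.flip_flip]
      rfl
  · rcases point_cases x y with ⟨a, b, hx, hy⟩ | ⟨a, b, hx, hy, hp⟩ | ⟨a, b, hx, hy, hp⟩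
    · rw [decompose_even X hx hy]
      rcases Int.even_or_odd y with hp | hp
      · exact (h.decompose_vertical_marks (y := y + 1) hx (by omega) (by grind)).2.1
      · have := (h.decompose_horizontal_marks (x := x) (y := y + 1) (a := a) (b := b + 1) (by omega)
          (by omega) (by grind)).2.2.2
        rwa [add_sub_cancel_right] at this
    · rw [decompose_even X (a := a + 1) (b := b) (by omega) (by omega),
        (h.decompose_horizontal_marks hx hy hp).2.2.1, Mark.flip_flip]
      rfl
    · rw [decompose_even X (a := a + 1) (b := b + 1) (by omega) (by omega),
        (h.decompose_vertical_marks hx hy hp).1]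
      exact h.northeast a b (by grind)
  · obtain ⟨a, ha⟩ := hxy
    rw [decompose_even X (x := x) (a := a) (b := y - a) (by omega) (by omega),
      decompose_even X (x := x + 1) (a := a + 1) (b := y - a) (by omega) (by omega)]
    exact h.east a (y - a)
  · obtain ⟨a, ha⟩ := hxy
    rw [decompose_even X (x := x) (a := a) (b := y - a) (by omega) (by omega),
      decompose_even X (x := x - 1) (a := a) (b := y - a + 1) (by omega) (by omega)]
    exact h.north a (y - a)

theorem isLegal_of_odd (h : IsAlignedGrid X) {x y : ℤ} (hxy : Odd (x + y)) : IsLegal (X x y) := by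
  rcases Int.even_or_odd y with hy | hy
  · obtain ⟨k, c, e, -, hX⟩ := h.horizontal x y (by grind) hy
    exact ⟨k, c, e, hX⟩
  · obtain ⟨k, c, e, -, hX⟩ := h.vertical x y (by grind) hy
    exact ⟨k, c, e, hX⟩

/-- After `2 n` decompositions, illegal crossings are left only at points divisible by `2 ^ n`. -/
theorem iterate_decompose (h : IsAlignedGrid X) (n : ℕ) : IsAlignedGrid (decompose^[2 * n] X) ∧
    ∀ x y, ¬ IsLegal (decompose^[2 * n] X x y) → (2 : ℤ) ^ n ∣ x ∧ (2 : ℤ) ^ n ∣ y := by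
  induction n with
  | zero => exact ⟨h, fun x y _ => by simp⟩
  | succ n ih =>
    obtain ⟨ih1, ih2⟩ := ih
    have hs : decompose^[2 * (n + 1)] X = decompose (decompose (decompose^[2 * n] X)) := by
      rw [mul_add, mul_one, add_comm, Function.iterate_add_apply]
      rfl
    rw [hs]
    refine ⟨ih1.decompose.decompose, fun x y hxy => ?_⟩
    obtain ⟨a, ha⟩ : Even (x + y) := by
      by_contra ho
      exact hxy (ih1.decompose.decompose.isLegal_of_odd (by grind))
    obtain ⟨b, rfl⟩ : ∃ b, y = a + b := ⟨y - a, by ring⟩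
    obtain rfl : x = a - b := by omega
    have h1 := fun hl => hxy (isLegal_decompose hl)
    obtain ⟨c, hc⟩ : Even (a + b) := by
      by_contra ho
      exact h1 (ih1.decompose.isLegal_of_odd (by grind))
    obtain ⟨d, rfl⟩ : ∃ d, b = c + d := ⟨b - c, by ring⟩
    obtain rfl : a = c - d := by omega
    obtain ⟨⟨p, hp⟩, ⟨q, hq⟩⟩ := ih2 c d fun hl => h1 (isLegal_decompose hl)
    exact ⟨⟨-q, by rw [hq]; ring⟩, ⟨p, by rw [hp]; ring⟩⟩

end IsAlignedGrid

/-- An aligned grid to start from. Its vertices need not be legal. -/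
def seed (x y : ℤ) : Fin 8 → Mark :=
  if Even (x + y) then
    if Even y then ![(true, .red), (true, .red), (true, .red), (true, .red),
      (false, .red), (false, .red), (false, .red), (false, .red)]
    else ![(true, .red), (true, .red), (true, .green), (true, .red),
      (true, .green), (false, .red), (true, .red), (false, .red)]
  else if Even y then legalMarks 0 .red .red else legalMarks 2 .red .red

theorem isAlignedGrid_seed : IsAlignedGrid seed := by
  refine ⟨fun x y hx hy => ⟨0, .red, .red, .inl rfl, ?_⟩,
    fun x y hx hy => ⟨2, .red, .red, .inl rfl, ?_⟩, fun x y => ?_, fun x y => ?_,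
    fun x y hxy => ?_, fun x y hxy => ?_⟩
  · have : ¬ Even (x + y) := by grind
    simp [seed, hy, this]
  · have h1 : ¬ Even (x + y) := by grind
    have h2 : ¬ Even y := by grind
    simp [seed, h1, h2]
  · by_cases hx : Even x <;> by_cases hy : Even y <;>
      simp only [seed, Int.even_add, hx, hy] <;> decide
  · by_cases hx : Even x <;> by_cases hy : Even y <;>
      simp only [seed, Int.even_add, hx, hy] <;> decide
  · have h2 : Even (x + 1 + (y + 1)) := by grind
    by_cases hy : Even y <;> simp only [seed, hxy, h2, hy, Int.even_add_one] <;> decide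
  · have h2 : Even (x - 1 + (y + 1)) := by grind
    by_cases hy : Even y <;> simp only [seed, hxy, h2, hy, Int.even_add_one] <;> decide

theorem IsAlignedGrid.translate {X : ℤ → ℤ → Fin 8 → Mark} (h : IsAlignedGrid X) {t : ℤ}
    (ht : Even t) : IsAlignedGrid fun x y => X (x + t) (y + t) := by
  refine ⟨fun x y hx hy => h.horizontal _ _ (by grind) (by grind),
    fun x y hx hy => h.vertical _ _ (by grind) (by grind), fun x y => ?_, fun x y => ?_,
    fun x y hxy => ?_, fun x y hxy => ?_⟩
  · simpa only [add_right_comm] using h.east (x + t) (y + t)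
  · simpa only [add_right_comm] using h.north (x + t) (y + t)
  · simpa only [add_right_comm] using h.northeast (x + t) (y + t) (by grind)
  · have := h.northwest (x + t) (y + t) (by grind)
    rwa [add_sub_right_comm, add_right_comm y] at this

/-- A limit of iterated decompositions, seen from points that are ever farther from the remaining
illegal vertices, is an aligned grid with legal vertices. The limit is taken pointwise along an
ultrafilter. -/
theorem exists_legal_grid : ∃ X, IsAlignedGrid X ∧ LegalVertices X := by
  let Y : ℕ → ℤ → ℤ → Fin 8 → Mark := fun n x y =>
    decompose^[2 * (n + 2)] seed (x + 2 ^ (n + 1)) (y + 2 ^ (n + 1))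
  have hY : ∀ n, IsAlignedGrid (Y n) := fun n =>
    (isAlignedGrid_seed.iterate_decompose (n + 2)).1.translate ⟨2 ^ n, by ring⟩
  have hleg : ∀ n : ℕ, ∀ x y : ℤ, |x| ≤ n → IsLegal (Y n x y) := by
    intro n x y hx
    by_contra hbad
    obtain ⟨q, hq⟩ := ((isAlignedGrid_seed.iterate_decompose (n + 2)).2 _ _ hbad).1
    have h2 : (n : ℤ) < 2 ^ (n + 1) := by
      exact_mod_cast (Nat.lt_two_pow_self (n := n)).trans (Nat.pow_lt_pow_right (by simp) (by simp))
    rw [pow_succ 2 (n + 1)] at hq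
    obtain ⟨hx1, hx2⟩ := abs_le.mp hx
    rcases lt_or_ge 0 q with h0 | h0 <;> nlinarith
  have hlim : ∀ x y, ∃ m, ∀ᶠ n in (Filter.hyperfilter ℕ : Filter ℕ), Y n x y = m := by
    intro x y
    have := (Filter.hyperfilter ℕ).eventually_exists_iff (P := fun m n => Y n x y = m)
    exact this.mp (.of_forall fun n => ⟨_, rfl⟩)
  choose X hX using hlim
  refine ⟨X, ⟨fun x y hx hy => ?_, fun x y hx hy => ?_, fun x y => ?_, fun x y => ?_,
    fun x y hxy => ?_, fun x y hxy => ?_⟩, fun x y _ => ?_⟩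
  · obtain ⟨n, hn⟩ := (hX x y).exists
    exact hn ▸ (hY n).horizontal x y hx hy
  · obtain ⟨n, hn⟩ := (hX x y).exists
    exact hn ▸ (hY n).vertical x y hx hy
  · obtain ⟨n, h1, h2⟩ := ((hX x y).and (hX (x + 1) y)).exists
    rw [← h1, ← h2]
    exact (hY n).east x y
  · obtain ⟨n, h1, h2⟩ := ((hX x y).and (hX x (y + 1))).exists
    rw [← h1, ← h2]
    exact (hY n).north x y
  · obtain ⟨n, h1, h2⟩ := ((hX x y).and (hX (x + 1) (y + 1))).exists
    rw [← h1, ← h2]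
    exact (hY n).northeast x y hxy
  · obtain ⟨n, h1, h2⟩ := ((hX x y).and (hX (x - 1) (y + 1))).exists
    rw [← h1, ← h2]
    exact (hY n).northwest x y hxy
  · have hlarge : ∀ᶠ n in (Filter.hyperfilter ℕ : Filter ℕ), x.natAbs ≤ n :=
      (Filter.eventually_ge_atTop x.natAbs).filter_mono
        (Nat.cofinite_eq_atTop ▸ Filter.hyperfilter_le_cofinite)
    obtain ⟨n, h1, h2⟩ := ((hX x y).and hlarge).exists
    rw [← h1]
    exact hleg n x y (by rw [Int.abs_eq_natAbs]; exact_mod_cast h2)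

/-! ### Side-to-side tilings by unit squares are lattice tilings -/

/-- The centres `(a, b)` of a side-to-side tiling of the plane by unit squares, as a relation
between the coordinates. This description is invariant under the symmetries of the square. -/
structure IsCenterSet (C : ℝ → ℝ → Prop) : Prop where
  sep : ∀ a b a' b', C a b → C a' b' → |a' - a| < 1 → |b' - b| < 1 → a' = a ∧ b' = b
  cover : ∀ p q, ∃ a b, C a b ∧ |p - a| ≤ 1 / 2 ∧ |q - b| ≤ 1 / 2
  align_right : ∀ a b b', C a b → C (a + 1) b' → |b' - b| ≤ 1 / 2 → b' = b
  align_up : ∀ a b a', C a b → C a' (b + 1) → |a' - a| ≤ 1 / 2 → a' = a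

namespace IsCenterSet

variable {C : ℝ → ℝ → Prop}

theorem reflect (h : IsCenterSet C) : IsCenterSet fun a b => C (-a) b where
  sep a b a' b' h1 h2 h3 h4 := by
    have := h.sep _ _ _ _ h1 h2 (by rwa [neg_sub_neg, abs_sub_comm]) h4
    exact ⟨neg_injective this.1, this.2⟩
  cover p q := by
    obtain ⟨a, b, h1, h2, h3⟩ := h.cover (-p) q
    refine ⟨-a, b, by simpa using h1, ?_, h3⟩
    rwa [sub_neg_eq_add, ← abs_neg, neg_add, ← sub_eq_add_neg]
  align_right a b b' h1 h2 h3 := by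
    have := h.align_right (-(a + 1)) b' b h2 (by convert h1 using 1; ring)
      (by rwa [abs_sub_comm])
    exact this.symm
  align_up a b a' h1 h2 h3 := by
    have := h.align_up _ _ _ h1 h2 (by rwa [neg_sub_neg, abs_sub_comm])
    exact neg_injective this

theorem swap (h : IsCenterSet C) : IsCenterSet fun a b => C b a where
  sep a b a' b' h1 h2 h3 h4 := (h.sep _ _ _ _ h1 h2 h4 h3).symm
  cover p q := by
    obtain ⟨a, b, h1, h2, h3⟩ := h.cover q p
    exact ⟨b, a, h1, h3, h2⟩
  align_right a b b' h1 h2 h3 := h.align_up _ _ _ h1 h2 h3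
  align_up a b b' h1 h2 h3 := h.align_right _ _ _ h1 h2 h3

/-- The points just to the right of the midpoint of the right side of a square are covered by
squares with centres in the strip at distance at least `1`. If none of these is at distance
exactly `1`, there are three of them at increasing distances; no two can have nearly the same
height, which leaves no room for the third. -/
theorem exists_right (h : IsCenterSet C) {a b : ℝ} (hab : C a b) : C (a + 1) b := by
  have near : ∀ ε : ℝ, 0 < ε → ε < 1 → ∃ p q, C p q ∧ 1 ≤ p - a ∧ p - a ≤ 1 + ε ∧
      |q - b| ≤ 1 / 2 := by
    intro ε h0 h1
    obtain ⟨p, q, hC, h2, h3⟩ := h.cover (a + 1 / 2 + ε) b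
    rw [abs_sub_comm] at h3
    obtain ⟨h4, h5⟩ := abs_le.mp h2
    refine ⟨p, q, hC, ?_, by linarith, h3⟩
    by_contra hlt
    have := (h.sep _ _ _ _ hab hC (by rw [abs_lt]; constructor <;> linarith) (by linarith)).1
    linarith
  have of_eq : ∀ p q, C p q → |q - b| ≤ 1 / 2 → p - a = 1 → C (a + 1) b := by
    intro p q hC hq hp
    obtain rfl : p = a + 1 := by linarith
    obtain rfl := h.align_right _ _ _ hab hC hq
    exact hC
  obtain ⟨p₁, q₁, hC₁, h1₁, h2₁, h3₁⟩ := near (1 / 2) (by norm_num) (by norm_num)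
  rcases h1₁.eq_or_lt with he₁ | he₁
  · exact of_eq _ _ hC₁ h3₁ he₁.symm
  obtain ⟨p₂, q₂, hC₂, h1₂, h2₂, h3₂⟩ := near ((p₁ - a - 1) / 2) (by linarith) (by linarith)
  rcases h1₂.eq_or_lt with he₂ | he₂
  · exact of_eq _ _ hC₂ h3₂ he₂.symm
  obtain ⟨p₃, q₃, hC₃, h1₃, h2₃, h3₃⟩ := near ((p₂ - a - 1) / 2) (by linarith) (by linarith)
  rcases h1₃.eq_or_lt with he₃ | he₃
  · exact of_eq _ _ hC₃ h3₃ he₃.symm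
  have far : ∀ p q p' q', C p q → C p' q' → p < p' → p' < p + 1 → 1 ≤ |q' - q| := by
    intro p q p' q' hC hC' hlt hlt'
    by_contra hq
    have := (h.sep _ _ _ _ hC hC' (by rw [abs_lt]; constructor <;> linarith)
      (by linarith)).1
    linarith
  have f1 := far _ _ _ _ hC₂ hC₁ (by linarith) (by linarith)
  have f2 := far _ _ _ _ hC₃ hC₁ (by linarith) (by linarith)
  have f3 := far _ _ _ _ hC₃ hC₂ (by linarith) (by linarith)
  rw [abs_le] at h3₁ h3₂ h3₃
  rw [le_abs] at f1 f2 f3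
  rcases f1 with f1 | f1 <;> rcases f2 with f2 | f2 <;> rcases f3 with f3 | f3 <;> linarith

theorem add_int_left (h : IsCenterSet C) {a b : ℝ} (hab : C a b) (i : ℤ) : C (a + i) b := by
  induction i using Int.induction_on with
  | zero => simpa using hab
  | succ i ih =>
    convert h.exists_right ih using 1
    push_cast; ring
  | pred i ih =>
    have := h.reflect.exists_right (a := -(a + (-(i : ℤ) : ℤ))) (b := b) (by simpa using ih)
    convert this using 1
    push_cast; ring

theorem add_int (h : IsCenterSet C) {a b : ℝ} (hab : C a b) (i j : ℤ) : C (a + i) (b + j) :=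
  h.swap.add_int_left (h.add_int_left hab i) j

theorem exists_int (h : IsCenterSet C) {a b a' b' : ℝ} (hab : C a b) (hab' : C a' b') :
    ∃ i j : ℤ, a' = a + i ∧ b' = b + j := by
  refine ⟨round (a' - a), round (b' - b), ?_⟩
  have h1 := abs_sub_round (a' - a)
  have h2 := abs_sub_round (b' - b)
  exact h.sep _ _ _ _ (h.add_int hab _ _) hab' (by rw [← sub_sub]; linarith)
    (by rw [← sub_sub]; linarith)

end IsCenterSet

theorem PlacedTile.mem_square {x : PlacedTile} {p : Plane} :
    p ∈ x.square ↔ |p.1 - x.center.1| ≤ 1 / 2 ∧ |p.2 - x.center.2| ≤ 1 / 2 := by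
  simp only [PlacedTile.square, Set.mem_Icc, Prod.le_def, Prod.fst_sub, Prod.snd_sub, Prod.fst_add,
    Prod.snd_add, abs_le]
  constructor
  · rintro ⟨⟨h1, h2⟩, h3, h4⟩
    exact ⟨⟨by linarith, by linarith⟩, by linarith, by linarith⟩
  · rintro ⟨⟨h1, h2⟩, h3, h4⟩
    exact ⟨⟨by linarith, by linarith⟩, by linarith, by linarith⟩

theorem PlacedTile.mem_interior_square {x : PlacedTile} {p : Plane} :
    p ∈ interior x.square ↔ |p.1 - x.center.1| < 1 / 2 ∧ |p.2 - x.center.2| < 1 / 2 := by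
  rw [PlacedTile.square, Set.Icc_prod_eq, interior_prod_eq, interior_Icc, interior_Icc,
    Set.mem_prod]
  simp only [Set.mem_Ioo, Prod.fst_sub, Prod.snd_sub, Prod.fst_add, Prod.snd_add, abs_lt]
  constructor
  · rintro ⟨⟨h1, h2⟩, h3, h4⟩
    exact ⟨⟨by linarith, by linarith⟩, by linarith, by linarith⟩
  · rintro ⟨⟨h1, h2⟩, h3, h4⟩
    exact ⟨⟨by linarith, by linarith⟩, by linarith, by linarith⟩

theorem disjoint_interior_square_iff {x y : PlacedTile} :
    Disjoint (interior x.square) (interior y.square) ↔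
      1 ≤ |y.center.1 - x.center.1| ∨ 1 ≤ |y.center.2 - x.center.2| := by
  rw [Set.disjoint_left]
  simp only [PlacedTile.mem_interior_square]
  constructor
  · intro h
    by_contra! hlt
    refine @h ((x.center.1 + y.center.1) / 2, (x.center.2 + y.center.2) / 2) ?_ ?_ <;>
      simp only [abs_lt] at hlt ⊢ <;> refine ⟨⟨?_, ?_⟩, ?_, ?_⟩ <;>
      linarith [hlt.1.1, hlt.1.2, hlt.2.1, hlt.2.2]
  · rintro h p ⟨h1, h2⟩ ⟨h3, h4⟩
    rw [abs_lt] at h1 h2 h3 h4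
    simp only [le_abs] at h
    rcases h with (h | h) | (h | h) <;> linarith

theorem PlacedTile.corner_mem_sideSegment (x : PlacedTile) (j : Fin 4) :
    x.corner j ∈ x.sideSegment j ∧ x.corner (j - 1) ∈ x.sideSegment j :=
  ⟨right_mem_segment _ _ _, left_mem_segment _ _ _⟩

/-- The centres of a correct tiling satisfy the hypotheses of the lattice argument. -/
theorem IsCorrectTiling.isCenterSet {T : Set PlacedTile} (h : IsCorrectTiling T) :
    IsCenterSet fun a b => ∃ t, (⟨(a, b), t⟩ : PlacedTile) ∈ T where
  sep := by
    rintro a b a' b' ⟨t, ht⟩ ⟨t', ht'⟩ h1 h2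
    by_cases he : (⟨(a, b), t⟩ : PlacedTile) = ⟨(a', b'), t'⟩
    · simp only [PlacedTile.mk.injEq, Prod.mk.injEq] at he
      exact ⟨he.1.1.symm, he.1.2.symm⟩
    · have := disjoint_interior_square_iff.mp (h.tiling.disjoint _ ht _ ht' he)
      rcases this with h3 | h3
      · exact absurd h1 (not_lt.mpr h3)
      · exact absurd h2 (not_lt.mpr h3)
  cover := by
    intro p q
    have : ((p, q) : Plane) ∈ ⋃ x ∈ T, x.square := h.tiling.cover ▸ Set.mem_univ _
    simp only [Set.mem_iUnion] at this
    obtain ⟨⟨⟨a, b⟩, t⟩, hx, hm⟩ := this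
    exact ⟨a, b, ⟨t, hx⟩, PlacedTile.mem_square.mp hm⟩
  align_right := by
    rintro a b b' ⟨t, ht⟩ ⟨t', ht'⟩ hb
    rw [abs_le] at hb
    obtain ⟨i, -, hi, -⟩ := h.sideToSide _ ht _ ht' (by simp) (by
      refine ⟨(a + 1 / 2, (b + b') / 2), ?_, (a + 1 / 2, (b + b') / 2 + 1 / 4), ?_, by simp⟩ <;>
        constructor <;> rw [PlacedTile.mem_square] <;> dsimp only <;> simp only [abs_le] <;>
        refine ⟨⟨?_, ?_⟩, ?_, ?_⟩ <;> linarith)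
    obtain ⟨m1, m2⟩ := PlacedTile.corner_mem_sideSegment ⟨(a, b), t⟩ i
    rw [← hi] at m1 m2
    have m3 := PlacedTile.mem_square.mp m1.2
    have m4 := PlacedTile.mem_square.mp m2.2
    simp only [abs_le] at m3 m4
    fin_cases i <;> simp [PlacedTile.corner, cornerOffset] at m3 m4 <;> linarith
  align_up := by
    rintro a b a' ⟨t, ht⟩ ⟨t', ht'⟩ hb
    rw [abs_le] at hb
    obtain ⟨i, -, hi, -⟩ := h.sideToSide _ ht _ ht' (by simp) (by
      refine ⟨((a + a') / 2, b + 1 / 2), ?_, ((a + a') / 2 + 1 / 4, b + 1 / 2), ?_, by simp⟩ <;>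
        constructor <;> rw [PlacedTile.mem_square] <;> dsimp only <;> simp only [abs_le] <;>
        refine ⟨⟨?_, ?_⟩, ?_, ?_⟩ <;> linarith)
    obtain ⟨m1, m2⟩ := PlacedTile.corner_mem_sideSegment ⟨(a, b), t⟩ i
    rw [← hi] at m1 m2
    have m3 := PlacedTile.mem_square.mp m1.2
    have m4 := PlacedTile.mem_square.mp m2.2
    simp only [abs_le] at m3 m4
    fin_cases i <;> simp [PlacedTile.corner, cornerOffset] at m3 m4 <;> linarith

/-- The tiling by the tiles `f i j` with centres `o + (i, j)`. -/
def latticeTiling (o : Plane) (f : ℤ → ℤ → Tile) : Set PlacedTile :=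
  {x | ∃ i j : ℤ, x = ⟨o + ((i : ℝ), (j : ℝ)), f i j⟩}

theorem IsCorrectTiling.exists_lattice {T : Set PlacedTile} (h : IsCorrectTiling T) :
    ∃ o f, T = latticeTiling o f := by
  have hC := h.isCenterSet
  obtain ⟨a, b, hab, -⟩ := hC.cover 0 0
  choose f hf using fun i j => hC.add_int hab i j
  refine ⟨(a, b), f, Set.ext fun x => ⟨fun hx => ?_, ?_⟩⟩
  · obtain ⟨i, j, h1, h2⟩ := hC.exists_int hab (⟨x.tile, hx⟩ : ∃ t,
      (⟨(x.center.1, x.center.2), t⟩ : PlacedTile) ∈ T)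
    refine ⟨i, j, ?_⟩
    by_contra hne
    have := disjoint_interior_square_iff.mp (h.tiling.disjoint _ hx _ (hf i j) hne)
    simp [h1, h2] at this
    linarith
  · rintro ⟨i, j, rfl⟩
    exact hf i j

/-! ### Arrows at a vertex -/

/-- The ray of the grid that leads from a tile centre to corner `d`. -/
def cornerRay : Fin 4 → Fin 8 := ![0, 2, 4, 6]

/-- The first coordinate of the grid step from a tile centre to corner `d`. -/
def stepX : Fin 4 → ℤ := ![1, 0, -1, 0]

/-- The second coordinate of the grid step from a tile centre to corner `d`. -/
def stepY : Fin 4 → ℤ := ![0, 1, 0, -1]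

theorem eq_of_smul_rayDir_eq {k l : Fin 8} {r s : ℝ} (hr : 0 < r) (hs : 0 < s)
    (h : r • rayDir k = s • rayDir l) : k = l := by
  have h1 := congrArg Prod.fst h
  have h2 := congrArg Prod.snd h
  fin_cases k <;> fin_cases l <;> first
    | rfl
    | (exfalso
       simp [rayDir] at h1 h2
       linarith)

theorem rayDir_add_four (k : Fin 8) : rayDir (k + 4) = -rayDir k := by
  fin_cases k <;> simp [rayDir]

/-- An arrow looks the same from its two ends, up to orientation and direction. -/
theorem hasProng_iff {p v : Plane} {k : Fin 8} {s : ℝ} {c : Color} {g : Prong} (hs : 0 < s) :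
    Arrow.HasProng ⟨p, p + s • rayDir k, c⟩ v g ↔
      v = p ∧ g = ⟨k, true, c⟩ ∨ v = p + s • rayDir k ∧ g = ⟨k + 4, false, c⟩ := by
  obtain ⟨l, o, d⟩ := g
  simp only [Arrow.HasProng, Prong.mk.injEq]
  cases o
  · simp only [Bool.false_eq_true, if_false, false_and, and_false, false_or, true_and]
    constructor
    · rintro ⟨rfl, r, hr, rfl, h⟩
      refine ⟨rfl, ?_, rfl⟩
      refine eq_of_smul_rayDir_eq hr hs ?_
      rw [rayDir_add_four, smul_neg]
      rw [add_assoc, left_eq_add] at h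
      exact (neg_eq_of_add_eq_zero_right h).symm
    · rintro ⟨rfl, rfl, rfl⟩
      exact ⟨rfl, s, hs, rfl, by rw [rayDir_add_four, smul_neg, add_neg_cancel_right]⟩
  · simp only [if_true, true_and, Bool.true_eq_false, false_and, and_false, or_false]
    constructor
    · rintro ⟨rfl, r, hr, rfl, h⟩
      exact ⟨rfl, (eq_of_smul_rayDir_eq hs hr (add_left_cancel h)).symm, rfl⟩
    · rintro ⟨rfl, rfl, rfl⟩
      exact ⟨rfl, s, hs, rfl, rfl⟩

namespace PlacedTile

theorem corner_eq_center_add (x : PlacedTile) (d : Fin 4) :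
    x.corner d = x.center + (1 / 2 : ℝ) • rayDir (cornerRay d + 1) := by
  fin_cases d <;> simp [corner, cornerOffset, cornerRay, rayDir] <;> norm_num

theorem center_eq_corner_add (x : PlacedTile) (d : Fin 4) :
    x.center = x.corner d + (1 / 2 : ℝ) • rayDir (cornerRay d + 1 + 4) := by
  rw [rayDir_add_four, corner_eq_center_add, smul_neg, add_neg_cancel_right]

theorem corner_eq_corner_add (x : PlacedTile) (d : Fin 4) :
    x.corner d = x.corner (d - 1) + (1 : ℝ) • rayDir (cornerRay d + 2) := by
  fin_cases d <;> simp [corner, cornerOffset, cornerRay, rayDir, add_assoc] <;> norm_num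

theorem corner_sub_one_eq_corner_add (x : PlacedTile) (d : Fin 4) :
    x.corner (d - 1) = x.corner d + (1 : ℝ) • rayDir (cornerRay d + 2 + 4) := by
  rw [rayDir_add_four, smul_neg, corner_eq_corner_add x d, add_neg_cancel_right]

theorem diagArrow_hasProng_iff (x : PlacedTile) (d : Fin 4) (v : Plane) (g : Prong) :
    (x.diagArrow d).HasProng v g ↔
      v = x.center ∧ g = ⟨cornerRay d + 1, x.tile.diagOutward d, x.tile.diagColor d⟩ ∨
      v = x.corner d ∧ g = ⟨cornerRay d + 5, !x.tile.diagOutward d, x.tile.diagColor d⟩ := by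
  have h5 : cornerRay d + 1 + 4 = cornerRay d + 5 := by rw [add_assoc]; rfl
  have h1 : cornerRay d + 1 + 4 + 4 = cornerRay d + 1 := by rw [add_assoc]; exact add_zero _
  unfold diagArrow
  cases x.tile.diagOutward d
  · have := hasProng_iff (p := x.corner d) (v := v) (k := cornerRay d + 1 + 4) (s := 1 / 2)
      (c := x.tile.diagColor d) (g := g) (by norm_num)
    rw [← center_eq_corner_add, h1, h5] at this
    simpa [or_comm] using this
  · have := hasProng_iff (p := x.center) (v := v) (k := cornerRay d + 1) (s := 1 / 2)
      (c := x.tile.diagColor d) (g := g) (by norm_num)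
    rw [← corner_eq_center_add, h5] at this
    simpa using this

theorem sideArrow_hasProng_iff (x : PlacedTile) (d : Fin 4) (v : Plane) (g : Prong) :
    (x.sideArrow d).HasProng v g ↔
      v = x.corner (d - 1) ∧ g = ⟨cornerRay d + 2, (x.tile.side d).ccw, (x.tile.side d).color⟩ ∨
      v = x.corner d ∧ g = ⟨cornerRay d + 6, !(x.tile.side d).ccw, (x.tile.side d).color⟩ := by
  have h6 : cornerRay d + 2 + 4 = cornerRay d + 6 := by rw [add_assoc]; rfl
  have h2 : cornerRay d + 2 + 4 + 4 = cornerRay d + 2 := by rw [add_assoc]; exact add_zero _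
  unfold sideArrow
  cases (x.tile.side d).ccw
  · have := hasProng_iff (p := x.corner d) (v := v) (k := cornerRay d + 2 + 4) (s := 1)
      (c := (x.tile.side d).color) (g := g) (by norm_num)
    rw [← corner_sub_one_eq_corner_add, h2, h6] at this
    simpa [or_comm] using this
  · have := hasProng_iff (p := x.corner (d - 1)) (v := v) (k := cornerRay d + 2) (s := 1)
      (c := (x.tile.side d).color) (g := g) (by norm_num)
    rw [← corner_eq_corner_add, h6] at this
    simpa using this

end PlacedTile

theorem mem_crossing_iff {T : Set PlacedTile} {v : Plane} {g : Prong} :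
    g ∈ crossing T v ↔ ∃ x ∈ T, ∃ d,
      (x.diagArrow d).HasProng v g ∨ (x.sideArrow d).HasProng v g := by
  constructor
  · rintro ⟨x, hx, a, ⟨d, rfl⟩ | ⟨d, rfl⟩, h⟩
    · exact ⟨x, hx, d, .inr h⟩
    · exact ⟨x, hx, d, .inl h⟩
  · rintro ⟨x, hx, d, h | h⟩
    · exact ⟨x, hx, _, .inr ⟨d, rfl⟩, h⟩
    · exact ⟨x, hx, _, .inl ⟨d, rfl⟩, h⟩

/-! ### Tilings as grids -/

/-- The point of the plane that corresponds to the grid point `(x, y)`, for a lattice tiling with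
origin `o`; the tile `(i, j)` has its centre at the grid point `(i + j + 1, j - i)`. -/
noncomputable def gridPoint (o : Plane) (x y : ℤ) : Plane :=
  o + (((x : ℝ) - 1 - y) / 2, ((x : ℝ) - 1 + y) / 2)

theorem gridPoint_inj {o : Plane} {x y x' y' : ℤ} :
    gridPoint o x y = gridPoint o x' y' ↔ x = x' ∧ y = y' := by
  constructor
  · intro h
    have h := add_left_cancel h
    rw [Prod.mk.injEq] at h
    constructor <;> rify <;> linarith
  · rintro ⟨rfl, rfl⟩; rfl

theorem center_eq_gridPoint (o : Plane) (i j : ℤ) :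
    o + ((i : ℝ), (j : ℝ)) = gridPoint o (i + j + 1) (j - i) := by
  unfold gridPoint
  congr 2 <;> push_cast <;> ring

theorem corner_eq_gridPoint (o : Plane) (i j : ℤ) (t : Tile) (d : Fin 4) :
    PlacedTile.corner ⟨o + ((i : ℝ), (j : ℝ)), t⟩ d =
      gridPoint o (i + j + 1 + stepX d) (j - i + stepY d) := by
  rw [PlacedTile.corner, gridPoint, add_assoc]
  congr 1
  fin_cases d <;> simp [cornerOffset, stepX, stepY] <;> constructor <;> ring

theorem exists_tile_of_odd {x y : ℤ} (h : Odd (x + y)) : ∃ i j : ℤ, x = i + j + 1 ∧ y = j - i := by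
  obtain ⟨j, hj⟩ := h
  exact ⟨x - j - 1, j, by ring, by omega⟩

theorem even_of_corner (i j : ℤ) (d : Fin 4) :
    Even (i + j + 1 + stepX d + (j - i + stepY d)) := by
  fin_cases d <;> simp [stepX, stepY] <;> grind

theorem exists_corner_of_even {x y : ℤ} (h : Even (x + y)) (d : Fin 4) :
    ∃ i j : ℤ, x = i + j + 1 + stepX d ∧ y = j - i + stepY d := by
  obtain ⟨i, j, hi, hj⟩ := exists_tile_of_odd (x := x - stepX d) (y := y - stepY d)
    (by fin_cases d <;> simp [stepX, stepY] <;> grind)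
  exact ⟨i, j, by omega, by omega⟩

/-- The grid `X` shows the tiles `f`: the tile `(i, j)` has its centre at the grid point
`(i + j + 1, j - i)`, and its arrows show up among the marks at its centre and its corners. -/
structure Shows (X : ℤ → ℤ → Fin 8 → Mark) (f : ℤ → ℤ → Tile) : Prop where
  center : ∀ i j, X (i + j + 1) (j - i) =
    legalMarks (cornerRay (f i j).axis) (f i j).axisColor (f i j).entryColor
  diag : ∀ i j d, X (i + j + 1 + stepX d) (j - i + stepY d) (cornerRay d + 4) =
    (!(f i j).diagOutward d, (f i j).diagColor d)
  start : ∀ i j d, X (i + j + 1 + stepX (d - 1)) (j - i + stepY (d - 1)) (cornerRay d + 1) =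
    (((f i j).side d).ccw, ((f i j).side d).color)
  finish : ∀ i j d, X (i + j + 1 + stepX d) (j - i + stepY d) (cornerRay d + 5) =
    (!((f i j).side d).ccw, ((f i j).side d).color)

theorem legalMarks_cornerRay (t : Tile) (d : Fin 4) :
    legalMarks (cornerRay t.axis) t.axisColor t.entryColor (cornerRay d) =
      (t.diagOutward d, t.diagColor d) := by
  obtain ⟨a, c, e, s⟩ := t
  simp only [Tile.diagOutward, Tile.diagColor]
  revert a c e d
  change ∀ d a c e, legalMarks (cornerRay a) c e (cornerRay d) =
    (decide (d = a), if d = a ∨ d = a + 2 then c else if d = a + 1 then e else e.other)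
  decide

theorem legalMarks_triangle (t : Tile) (d : Fin 4) :
    (legalMarks (cornerRay t.axis) t.axisColor t.entryColor (cornerRay d + 7)).2 =
      t.triangleColor d := by
  obtain ⟨a, c, e, s⟩ := t
  simp only [Tile.triangleColor]
  revert a c e d
  change ∀ d a c e, (legalMarks (cornerRay a) c e (cornerRay d + 7)).2 =
    if d = a + 1 ∨ d = a + 3 then Color.red else Color.green
  decide

theorem exists_cornerRay (r : Fin 8) :
    ∃ d, r = cornerRay d + 4 ∨ r = cornerRay d + 1 := by
  revert r; decide

/-- The tiles determine the grid; so a period of the tiles is a period of the grid. -/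
theorem Shows.unique {X Y : ℤ → ℤ → Fin 8 → Mark} {f : ℤ → ℤ → Tile} (hX : Shows X f)
    (hY : Shows Y f) : X = Y := by
  funext x y
  rcases Int.even_or_odd (x + y) with h | h
  · funext r
    obtain ⟨d, rfl | rfl⟩ := exists_cornerRay r
    · obtain ⟨i, j, rfl, rfl⟩ := exists_corner_of_even h d
      rw [hX.diag, hY.diag]
    · obtain ⟨i, j, rfl, rfl⟩ := exists_corner_of_even h (d - 1)
      rw [hX.start, hY.start]
  · obtain ⟨i, j, rfl, rfl⟩ := exists_tile_of_odd h
    rw [hX.center, hY.center]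

/-- In a grid that shows a tiling, the marks at a vertex are the prongs of its crossing. -/
theorem Shows.mem_crossing_iff {X : ℤ → ℤ → Fin 8 → Mark} {f : ℤ → ℤ → Tile} (h : Shows X f)
    (o : Plane) {x y : ℤ} (hxy : Even (x + y)) (g : Prong) :
    g ∈ crossing (latticeTiling o f) (gridPoint o x y) ↔
      X x y (g.ray - 1) = (g.outgoing, g.color) := by
  rw [SquareTiling.mem_crossing_iff]
  constructor
  · rintro ⟨_, ⟨i, j, rfl⟩, d, hg | hg⟩
    · rw [PlacedTile.diagArrow_hasProng_iff, corner_eq_gridPoint, center_eq_gridPoint,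
        gridPoint_inj, gridPoint_inj] at hg
      rcases hg with ⟨⟨rfl, rfl⟩, -⟩ | ⟨⟨rfl, rfl⟩, rfl⟩
      · exfalso
        grind
      · rw [← h.diag i j d]
        congr 1
        exact add_sub_assoc (cornerRay d) 5 1
    · rw [PlacedTile.sideArrow_hasProng_iff, corner_eq_gridPoint, corner_eq_gridPoint,
        gridPoint_inj, gridPoint_inj] at hg
      rcases hg with ⟨⟨rfl, rfl⟩, rfl⟩ | ⟨⟨rfl, rfl⟩, rfl⟩
      · rw [← h.start i j d]
        congr 1
        exact add_sub_assoc (cornerRay d) 2 1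
      · rw [← h.finish i j d]
        congr 1
        exact add_sub_assoc (cornerRay d) 6 1
  · intro hg
    obtain ⟨r, out, c⟩ := g
    dsimp only at hg
    obtain ⟨d, hr | hr⟩ := exists_cornerRay (r - 1)
    · obtain ⟨i, j, rfl, rfl⟩ := exists_corner_of_even hxy d
      rw [hr, h.diag, Prod.mk.injEq] at hg
      refine ⟨_, ⟨i, j, rfl⟩, d, .inl ?_⟩
      rw [PlacedTile.diagArrow_hasProng_iff, corner_eq_gridPoint]
      refine .inr ⟨rfl, ?_⟩
      rw [hg.1, hg.2, sub_eq_iff_eq_add.mp hr, add_assoc]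
      rfl
    · obtain ⟨i, j, rfl, rfl⟩ := exists_corner_of_even hxy (d - 1)
      rw [hr, h.start, Prod.mk.injEq] at hg
      refine ⟨_, ⟨i, j, rfl⟩, d, .inr ?_⟩
      rw [PlacedTile.sideArrow_hasProng_iff, corner_eq_gridPoint]
      refine .inl ⟨rfl, ?_⟩
      rw [hg.1, hg.2, sub_eq_iff_eq_add.mp hr, add_assoc]
      rfl

/-- A correct tiling gives a grid with legal vertices. -/
theorem exists_shows {o : Plane} {f : ℤ → ℤ → Tile} (h : IsCorrectTiling (latticeTiling o f)) :
    ∃ X, Shows X f ∧ LegalVertices X := by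
  have hv : ∀ x y : ℤ, ∃ m : Fin 8 → Mark,
      (Even (x + y) → IsLegal m ∧ ∀ g ∈ crossing (latticeTiling o f) (gridPoint o x y),
        m (g.ray - 1) = (g.outgoing, g.color)) ∧
      ∀ i j, x = i + j + 1 → y = j - i →
        m = legalMarks (cornerRay (f i j).axis) (f i j).axisColor (f i j).entryColor := by
    intro x y
    rcases Int.even_or_odd (x + y) with hxy | hxy
    · obtain ⟨i, j, rfl, rfl⟩ := exists_corner_of_even hxy 0
      obtain ⟨k, c, e, hk⟩ := h.crossingsLegal _ ⟨i, j, rfl⟩ 0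
      rw [corner_eq_gridPoint] at hk
      refine ⟨legalMarks (k - 1) c e, fun _ => ⟨⟨_, _, _, rfl⟩, fun g hg => ?_⟩,
        fun i' j' h1 h2 => ?_⟩
      · rw [hk, mem_legalCrossing] at hg
        rw [legalMarks_sub_one, sub_add_cancel, hg]
      · simp only [stepX, stepY, Matrix.cons_val_zero] at h1 h2
        omega
    · obtain ⟨i, j, rfl, rfl⟩ := exists_tile_of_odd hxy
      refine ⟨legalMarks (cornerRay (f i j).axis) (f i j).axisColor (f i j).entryColor,
        fun he => absurd he (by grind), fun i' j' h1 h2 => ?_⟩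
      obtain rfl : i = i' := by omega
      obtain rfl : j = j' := by omega
      rfl
  choose X hX using hv
  refine ⟨X, ⟨fun i j => (hX _ _).2 i j rfl rfl, fun i j d => ?_, fun i j d => ?_,
    fun i j d => ?_⟩, fun x y hxy => ((hX x y).1 hxy).1⟩
  · have := ((hX _ _).1 (even_of_corner i j d)).2
      ⟨cornerRay d + 5, !(f i j).diagOutward d, (f i j).diagColor d⟩
      (mem_crossing_iff.mpr ⟨_, ⟨i, j, rfl⟩, d, .inl
        ((PlacedTile.diagArrow_hasProng_iff _ _ _ _).mpr
          (.inr ⟨(corner_eq_gridPoint _ _ _ _ _).symm, rfl⟩))⟩)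
    rw [← this]
    congr 1
    exact (add_sub_assoc (cornerRay d) 5 1).symm
  · have := ((hX _ _).1 (even_of_corner i j (d - 1))).2
      ⟨cornerRay d + 2, ((f i j).side d).ccw, ((f i j).side d).color⟩
      (mem_crossing_iff.mpr ⟨_, ⟨i, j, rfl⟩, d, .inr
        ((PlacedTile.sideArrow_hasProng_iff _ _ _ _).mpr
          (.inl ⟨(corner_eq_gridPoint _ _ _ _ _).symm, rfl⟩))⟩)
    rw [← this]
    congr 1
    exact (add_sub_assoc (cornerRay d) 2 1).symm
  · have := ((hX _ _).1 (even_of_corner i j d)).2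
      ⟨cornerRay d + 6, !((f i j).side d).ccw, ((f i j).side d).color⟩
      (mem_crossing_iff.mpr ⟨_, ⟨i, j, rfl⟩, d, .inr
        ((PlacedTile.sideArrow_hasProng_iff _ _ _ _).mpr
          (.inr ⟨(corner_eq_gridPoint _ _ _ _ _).symm, rfl⟩))⟩)
    rw [← this]
    congr 1
    exact (add_sub_assoc (cornerRay d) 6 1).symm

theorem sideSegment_eq_opposite {x y : PlacedTile} {d : Fin 4}
    (h1 : x.corner (d - 1) = y.corner (d + 2)) (h2 : x.corner d = y.corner (d + 1)) :
    x.sideSegment d = y.sideSegment (d + 2) := by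
  unfold PlacedTile.sideSegment
  have : d + 2 - 1 = d + 1 := add_sub_assoc d 2 1
  rw [h1, h2, this, segment_symm]

/-- The grid that shows a tiling satisfies all conditions on grids. The matching of sides comes from
the crossings at their ends, each of which has only one arrow on each ray. -/
theorem Shows.isGrid {X : ℤ → ℤ → Fin 8 → Mark} {f : ℤ → ℤ → Tile} (h : Shows X f) {o : Plane}
    (hT : TrianglesAlternate (latticeTiling o f)) : IsGrid X := by
  have hdiag : ∀ i j d, X (i + j + 1) (j - i) (cornerRay d) =
      (X (i + j + 1 + stepX d) (j - i + stepY d) (cornerRay d + 4)).flip := by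
    intro i j d
    rw [h.diag, h.center, legalMarks_cornerRay]
    simp [Mark.flip]
  have hside : ∀ i j d, X (i + j + 1 + stepX d) (j - i + stepY d) (cornerRay d + 5) =
      (X (i + j + 1 + stepX (d - 1)) (j - i + stepY (d - 1)) (cornerRay d + 1)).flip := by
    intro i j d
    rw [h.start, h.finish]
    rfl
  have htri : ∀ i j d, (X (i + j + 1) (j - i) (cornerRay d + 7)).2 = (f i j).triangleColor d := by
    intro i j d
    rw [h.center, legalMarks_triangle]
  refine ⟨fun x y hxy => ?_, fun x y => ?_, fun x y => ?_, fun x y hxy => ?_, fun x y hxy => ?_,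
    fun x y hxy => ?_, fun x y hxy => ?_⟩
  · obtain ⟨i, j, rfl, rfl⟩ := exists_tile_of_odd hxy
    refine ⟨_, _, _, ?_, h.center i j⟩
    generalize (f i j).axis = a
    revert a; decide
  · rcases Int.even_or_odd (x + y) with hxy | hxy
    · obtain ⟨i, j, h1, h2⟩ := exists_tile_of_odd (x := x + 1) (y := y) (by grind)
      have := hdiag i j 2
      rw [← h1, ← h2] at this
      simpa [cornerRay, stepX, stepY] using this
    · obtain ⟨i, j, h1, h2⟩ := exists_tile_of_odd hxy
      have := hdiag i j 0
      rw [← h1, ← h2] at this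
      simp only [cornerRay, stepX, stepY, Matrix.cons_val_zero, add_zero, zero_add] at this
      rw [this, Mark.flip_flip]
  · rcases Int.even_or_odd (x + y) with hxy | hxy
    · obtain ⟨i, j, h1, h2⟩ := exists_tile_of_odd (x := x) (y := y + 1) (by grind)
      have := hdiag i j 3
      rw [← h1, ← h2] at this
      simpa [cornerRay, stepX, stepY] using this
    · obtain ⟨i, j, h1, h2⟩ := exists_tile_of_odd hxy
      have := hdiag i j 1
      rw [← h1, ← h2] at this
      simp only [cornerRay, stepX, stepY, Matrix.cons_val_one, Matrix.cons_val_zero,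
        add_zero] at this
      rw [this, Mark.flip_flip]
      rfl
  · obtain ⟨i, j, h1, h2⟩ := exists_tile_of_odd (x := x) (y := y + 1) (by grind)
    have := hside i j 0
    rw [← h1, ← h2] at this
    simpa [cornerRay, stepX, stepY] using this
  · obtain ⟨i, j, h1, h2⟩ := exists_tile_of_odd (x := x - 1) (y := y) (by grind)
    have := hside i j 1
    rw [← h1, ← h2] at this
    simpa [cornerRay, stepX, stepY] using this
  · obtain ⟨i, j, rfl, rfl⟩ := exists_tile_of_odd hxy
    have h1 := htri i j 1
    have h2 := htri i (j + 1) 3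
    have e1 : i + (j + 1) + 1 = i + j + 1 + 1 := by ring
    have e2 : j + 1 - i = j - i + 1 := by ring
    rw [e1, e2] at h2
    have := hT _ ⟨i, j, rfl⟩ _ ⟨i, j + 1, rfl⟩ (by simp) 1 3
      (sideSegment_eq_opposite
        (by rw [corner_eq_gridPoint, corner_eq_gridPoint, gridPoint_inj]
            constructor <;> simp [stepX, stepY] <;> ring)
        (by rw [corner_eq_gridPoint, corner_eq_gridPoint, gridPoint_inj]
            constructor <;> simp [stepX, stepY] <;> ring))
    rw [← h1, ← h2] at this
    exact this
  · obtain ⟨i, j, rfl, rfl⟩ := exists_tile_of_odd hxy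
    have h1 := htri i j 2
    have h2 := htri (i - 1) j 0
    have e1 : i - 1 + j + 1 = i + j + 1 - 1 := by ring
    have e2 : j - (i - 1) = j - i + 1 := by ring
    rw [e1, e2] at h2
    have := hT _ ⟨i, j, rfl⟩ _ ⟨i - 1, j, rfl⟩
      (fun he => by simp [eq_sub_iff_add_eq] at he) 2 0
      (sideSegment_eq_opposite (d := 2)
        (by rw [corner_eq_gridPoint, corner_eq_gridPoint, gridPoint_inj]
            constructor <;> simp [stepX, stepY] <;> ring)
        (by rw [corner_eq_gridPoint, corner_eq_gridPoint, gridPoint_inj]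
            constructor <;> simp [stepX, stepY] <;> ring))
    rw [← h1, ← h2] at this
    exact this

theorem Shows.translate {X : ℤ → ℤ → Fin 8 → Mark} {f : ℤ → ℤ → Tile} (h : Shows X f) {s t : ℤ}
    (hf : ∀ i j, f (i + s) (j + t) = f i j) : Shows (fun x y => X (x + (s + t)) (y + (t - s))) f := by
  have e1 : ∀ i j u : ℤ, i + j + 1 + u + (s + t) = i + s + (j + t) + 1 + u := fun i j u => by ring
  have e2 : ∀ i j u : ℤ, j - i + u + (t - s) = j + t - (i + s) + u := fun i j u => by ring
  refine ⟨fun i j => ?_, fun i j d => ?_, fun i j d => ?_, fun i j d => ?_⟩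
  · have := h.center (i + s) (j + t)
    rw [hf, ← add_zero (i + s + (j + t) + 1), ← add_zero (j + t - (i + s)), ← e1, ← e2, add_zero,
      add_zero] at this
    exact this
  · rw [e1, e2, h.diag, hf]
  · rw [e1, e2, h.start, hf]
  · rw [e1, e2, h.finish, hf]

theorem IsCorrectTiling.isNonPeriodic {T : Set PlacedTile} (hT : IsCorrectTiling T) :
    IsNonPeriodic T := by
  obtain ⟨o, f, rfl⟩ := hT.exists_lattice
  intro a ha hper
  have hmem : ∀ i j : ℤ, (⟨o + ((i : ℝ), (j : ℝ)) + a, f i j⟩ : PlacedTile) ∈ latticeTiling o f :=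
    fun i j => hper ▸ ⟨⟨_, f i j⟩, ⟨i, j, rfl⟩, rfl⟩
  obtain ⟨s, t, hst⟩ := hmem 0 0
  obtain rfl : a = ((s : ℝ), (t : ℝ)) := by
    have := (PlacedTile.mk.injEq .. ▸ hst).1
    simpa [Prod.ext_iff] using this
  have hf : ∀ i j, f (i + s) (j + t) = f i j := by
    intro i j
    obtain ⟨i', j', h⟩ := hmem i j
    rw [PlacedTile.mk.injEq, add_assoc, add_right_inj, Prod.mk_add_mk, Prod.mk.injEq] at h
    obtain ⟨⟨h1, h2⟩, h3⟩ := h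
    obtain rfl : i + s = i' := by exact_mod_cast h1
    obtain rfl : j + t = j' := by exact_mod_cast h2
    exact h3.symm
  obtain ⟨X, hX, hl⟩ := exists_shows hT
  have hp := (hX.translate hf).unique hX
  obtain ⟨h1, h2⟩ := (hX.isGrid hT.trianglesAlternate).period_eq_zero hl (a := s + t) (b := t - s)
    ⟨t, by ring⟩ (fun x y => congrFun (congrFun hp x) y)
  obtain rfl : s = 0 := by omega
  obtain rfl : t = 0 := by omega
  exact ha (by simp)

/-! ### Grids as tilings -/

theorem PlacedTile.mem_sideSegment {a b : ℝ} {t : Tile} {d : Fin 4} {p : Plane} :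
    p ∈ PlacedTile.sideSegment ⟨(a, b), t⟩ d ↔
      ![p.1 = a + 1 / 2 ∧ |p.2 - b| ≤ 1 / 2, p.2 = b + 1 / 2 ∧ |p.1 - a| ≤ 1 / 2,
        p.1 = a - 1 / 2 ∧ |p.2 - b| ≤ 1 / 2, p.2 = b - 1 / 2 ∧ |p.1 - a| ≤ 1 / 2] d := by
  obtain ⟨p, q⟩ := p
  simp only [sideSegment, segment, corner, Set.mem_ofPred_eq, abs_le]
  fin_cases d <;> simp [cornerOffset, Prod.ext_iff]
  all_goals constructor
  · rintro ⟨u, hu, v, hv, huv, rfl, rfl⟩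
    refine ⟨?_, ?_, ?_⟩ <;> obtain rfl := eq_sub_of_add_eq huv <;> nlinarith
  · rintro ⟨rfl, h1, h2⟩
    exact ⟨1 / 2 - (q - b), by linarith, 1 / 2 + (q - b), by linarith, by ring, by ring, by ring⟩
  · rintro ⟨u, hu, v, hv, huv, rfl, rfl⟩
    refine ⟨?_, ?_, ?_⟩ <;> obtain rfl := eq_sub_of_add_eq huv <;> nlinarith
  · rintro ⟨rfl, h1, h2⟩
    exact ⟨1 / 2 + (p - a), by linarith, 1 / 2 - (p - a), by linarith, by ring, by ring, by ring⟩
  · rintro ⟨u, hu, v, hv, huv, rfl, rfl⟩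
    refine ⟨?_, ?_, ?_⟩ <;> obtain rfl := eq_sub_of_add_eq huv <;> nlinarith
  · rintro ⟨rfl, h1, h2⟩
    exact ⟨1 / 2 + (q - b), by linarith, 1 / 2 - (q - b), by linarith, by ring, by ring, by ring⟩
  · rintro ⟨u, hu, v, hv, huv, rfl, rfl⟩
    refine ⟨?_, ?_, ?_⟩ <;> obtain rfl := eq_sub_of_add_eq huv <;> nlinarith
  · rintro ⟨rfl, h1, h2⟩
    exact ⟨1 / 2 - (p - a), by linarith, 1 / 2 + (p - a), by linarith, by ring, by ring, by ring⟩

/-- Squares share a side only if they are equal or adjacent. -/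
theorem sideSegment_eq_cases {x y : PlacedTile} {i j : Fin 4}
    (h : x.sideSegment i = y.sideSegment j) :
    (j = i ∧ y.center = x.center) ∨
      (j = i + 2 ∧ y.corner j = x.corner (i - 1) ∧ y.corner (j - 1) = x.corner i) := by
  obtain ⟨m1, m2⟩ := x.corner_mem_sideSegment i
  obtain ⟨m3, m4⟩ := y.corner_mem_sideSegment j
  rw [h] at m1 m2
  rw [← h] at m3 m4
  obtain ⟨⟨a, b⟩, t⟩ := x
  obtain ⟨⟨a', b'⟩, t'⟩ := y
  rw [PlacedTile.mem_sideSegment] at m1 m2 m3 m4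
  fin_cases i <;> fin_cases j <;>
    simp [PlacedTile.corner, cornerOffset, abs_le] at m1 m2 m3 m4 ⊢ <;>
    first
      | (constructor <;> linarith)
      | (exfalso; linarith)

theorem isTilingOfPlane_latticeTiling (o : Plane) (f : ℤ → ℤ → Tile) :
    IsTilingOfPlane (latticeTiling o f) where
  disjoint := by
    rintro _ ⟨i, j, rfl⟩ _ ⟨i', j', rfl⟩ hne
    rw [disjoint_interior_square_iff]
    simp only [Prod.fst_add, Prod.snd_add, add_sub_add_left_eq_sub]
    by_contra! hlt
    have h1 : |i' - i| < 1 := by exact_mod_cast hlt.1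
    have h2 : |j' - j| < 1 := by exact_mod_cast hlt.2
    rw [Int.abs_lt_one_iff, sub_eq_zero] at h1 h2
    exact hne (by rw [h1, h2])
  cover := by
    rw [Set.eq_univ_iff_forall]
    intro p
    simp only [Set.mem_iUnion]
    refine ⟨_, ⟨round (p.1 - o.1), round (p.2 - o.2), rfl⟩, PlacedTile.mem_square.mpr ⟨?_, ?_⟩⟩
    · rw [Prod.fst_add, ← sub_sub]
      exact abs_sub_round _
    · rw [Prod.snd_add, ← sub_sub]
      exact abs_sub_round _

theorem sideToSide_latticeTiling (o : Plane) (f : ℤ → ℤ → Tile) :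
    SideToSide (latticeTiling o f) := by
  rintro _ ⟨i, j, rfl⟩ _ ⟨i', j', rfl⟩ hne ⟨p, ⟨hp1, hp2⟩, q, ⟨hq1, hq2⟩, hpq⟩
  have hne' : ¬ (i = i' ∧ j = j') := fun ⟨h1, h2⟩ => hne (by rw [h1, h2])
  obtain ⟨a, b⟩ := o
  simp only [PlacedTile.mem_square, Prod.mk_add_mk, abs_le] at hp1 hp2 hq1 hq2
  have hi1 : i' ≤ i + 1 := by rify; linarith [hp1.1.2, hp2.1.1]
  have hi2 : i ≤ i' + 1 := by rify; linarith [hp2.1.2, hp1.1.1]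
  have hj1 : j' ≤ j + 1 := by rify; linarith [hp1.2.2, hp2.2.1]
  have hj2 : j ≤ j' + 1 := by rify; linarith [hp2.2.2, hp1.2.1]
  -- Diagonal neighbours have only one point in common.
  have hdiag : i = i' ∨ j = j' := by
    by_contra! hd
    apply hpq
    have h1 : i' = i + 1 ∨ i = i' + 1 := by omega
    have h2 : j' = j + 1 ∨ j = j' + 1 := by omega
    rcases h1 with rfl | rfl <;> rcases h2 with rfl | rfl <;> push_cast at hp1 hp2 hq1 hq2 <;>
      ext <;> linarith [hp1.1.1, hp1.1.2, hp1.2.1, hp1.2.2, hp2.1.1, hp2.1.2, hp2.2.1, hp2.2.2,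
        hq1.1.1, hq1.1.2, hq1.2.1, hq1.2.2, hq2.1.1, hq2.1.2, hq2.2.1, hq2.2.2]
  have hcases : (i' = i + 1 ∧ j = j') ∨ (i = i' ∧ j' = j + 1) ∨ (i = i' + 1 ∧ j = j') ∨
      (i = i' ∧ j = j' + 1) := by omega
  rcases hcases with ⟨rfl, rfl⟩ | ⟨rfl, rfl⟩ | ⟨rfl, rfl⟩ | ⟨rfl, rfl⟩
  · refine ⟨0, 2, ?_, ?_⟩ <;> ext ⟨u, v⟩ <;>
      simp only [Set.mem_inter_iff, PlacedTile.mem_square, Prod.mk_add_mk,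
        PlacedTile.mem_sideSegment, abs_le] <;> simp <;> grind
  · refine ⟨1, 3, ?_, ?_⟩ <;> ext ⟨u, v⟩ <;>
      simp only [Set.mem_inter_iff, PlacedTile.mem_square, Prod.mk_add_mk,
        PlacedTile.mem_sideSegment, abs_le] <;> simp <;> grind
  · refine ⟨2, 0, ?_, ?_⟩ <;> ext ⟨u, v⟩ <;>
      simp only [Set.mem_inter_iff, PlacedTile.mem_square, Prod.mk_add_mk,
        PlacedTile.mem_sideSegment, abs_le] <;> simp <;> grind
  · refine ⟨3, 1, ?_, ?_⟩ <;> ext ⟨u, v⟩ <;>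
      simp only [Set.mem_inter_iff, PlacedTile.mem_square, Prod.mk_add_mk,
        PlacedTile.mem_sideSegment, abs_le] <;> simp <;> grind

/-- Every aligned grid shows some tiles. -/
theorem IsAlignedGrid.exists_shows {X : ℤ → ℤ → Fin 8 → Mark} (h : IsAlignedGrid X) :
    ∃ f, Shows X f := by
  have hc : ∀ i j : ℤ, ∃ (a : Fin 4) (c e : Color),
      X (i + j + 1) (j - i) = legalMarks (cornerRay a) c e := by
    intro i j
    rcases Int.even_or_odd (j - i) with hp | hp
    · obtain ⟨k, c, e, rfl | rfl, hX⟩ := h.horizontal (i + j + 1) (j - i) (by grind) hp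
      · exact ⟨0, c, e, hX⟩
      · exact ⟨2, c, e, hX⟩
    · obtain ⟨k, c, e, rfl | rfl, hX⟩ := h.vertical (i + j + 1) (j - i) (by grind) hp
      · exact ⟨1, c, e, hX⟩
      · exact ⟨3, c, e, hX⟩
  choose a c e hX using hc
  let f : ℤ → ℤ → Tile := fun i j => ⟨a i j, c i j, e i j, fun d =>
    let m := X (i + j + 1 + stepX (d - 1)) (j - i + stepY (d - 1)) (cornerRay d + 1)
    ⟨m.1, m.2⟩⟩
  refine ⟨f, hX, fun i j d => ?_, fun i j d => rfl, fun i j d => ?_⟩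
  · have hr : X (i + j + 1) (j - i) (cornerRay d) = ((f i j).diagOutward d, (f i j).diagColor d) :=
      hX i j ▸ legalMarks_cornerRay (f i j) d
    have : X (i + j + 1 + stepX d) (j - i + stepY d) (cornerRay d + 4) =
        (X (i + j + 1) (j - i) (cornerRay d)).flip := by
      generalize i + j + 1 = x
      generalize j - i = y
      fin_cases d
      · simpa [stepX, stepY, cornerRay] using h.east x y
      · simpa [stepX, stepY, cornerRay] using h.north x y
      · have := h.east (x - 1) y
        rw [sub_add_cancel] at this
        simp [stepX, stepY, cornerRay, this, ← sub_eq_add_neg]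
      · have := h.north x (y - 1)
        rw [sub_add_cancel] at this
        simp [stepX, stepY, cornerRay, this, ← sub_eq_add_neg]
    rw [this, hr]
    rfl
  · change _ = (X (i + j + 1 + stepX (d - 1)) (j - i + stepY (d - 1)) (cornerRay d + 1)).flip
    have hp : Odd (i + j + 1 + (j - i)) := ⟨j, by ring⟩
    generalize i + j + 1 = x at hp
    generalize j - i = y at hp
    fin_cases d
    · have := h.northeast x (y - 1) (by grind)
      rw [sub_add_cancel] at this
      simpa [stepX, stepY, cornerRay, ← sub_eq_add_neg] using this
    · have := h.northwest (x + 1) y (by grind)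
      rw [add_sub_cancel_right] at this
      simpa [stepX, stepY, cornerRay] using this
    · have := h.northeast (x - 1) y (by grind)
      rw [sub_add_cancel] at this
      simp [stepX, stepY, cornerRay, this, ← sub_eq_add_neg]
    · have := h.northwest x (y - 1) (by grind)
      rw [sub_add_cancel] at this
      simp [stepX, stepY, cornerRay, this, ← sub_eq_add_neg]

/-- In an aligned grid the colours of the triangles depend only on their position. -/
theorem IsAlignedGrid.triangleColor_eq {X : ℤ → ℤ → Fin 8 → Mark} {f : ℤ → ℤ → Tile}
    (hX : IsAlignedGrid X) (h : Shows X f) (i j : ℤ) (d : Fin 4) :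
    (f i j).triangleColor d = .red ↔ (Even (j - i) ↔ d = 1 ∨ d = 3) := by
  rw [← legalMarks_triangle, ← h.center]
  rcases Int.even_or_odd (j - i) with hp | hp
  · obtain ⟨h1, h3, h5, h7⟩ := hX.marks_horizontal (x := i + j + 1) (by grind) hp
    fin_cases d <;> simp [cornerRay, h1, h3, h5, h7, hp]
  · obtain ⟨h1, h3, h5, h7⟩ := hX.marks_vertical (x := i + j + 1) (by grind) hp
    have hp' : ¬ Even (j - i) := by grind
    fin_cases d <;> simp [cornerRay, h1, h3, h5, h7, hp']

/-- An aligned grid with legal vertices gives a correct tiling. -/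
theorem IsAlignedGrid.isCorrectTiling {X : ℤ → ℤ → Fin 8 → Mark} {f : ℤ → ℤ → Tile}
    (hX : IsAlignedGrid X) (hl : LegalVertices X) (h : Shows X f) (o : Plane) :
    IsCorrectTiling (latticeTiling o f) := by
  refine ⟨isTilingOfPlane_latticeTiling o f, sideToSide_latticeTiling o f, ?_, ?_, ?_⟩
  · rintro _ ⟨i, j, rfl⟩ _ ⟨i', j', rfl⟩ d d' hs
    rcases sideSegment_eq_cases hs with ⟨rfl, hc⟩ | ⟨rfl, h1, h2⟩
    · rw [center_eq_gridPoint, center_eq_gridPoint, gridPoint_inj] at hc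
      obtain rfl : i' = i := by omega
      obtain rfl : j' = j := by omega
      rfl
    · have hstart := h.start i j d
      have hfinish := h.finish i' j' (d + 2)
      have hr : cornerRay (d + 2) + 5 = cornerRay d + 1 := by clear * -; revert d; decide
      have hpt := h1
      rw [corner_eq_gridPoint, corner_eq_gridPoint, gridPoint_inj] at hpt
      rw [hr, hpt.1, hpt.2, hstart, Prod.mk.injEq] at hfinish
      unfold PlacedTile.sideArrow
      rw [h1, h2, hfinish.1, hfinish.2]
      cases ((f i' j').side (d + 2)).ccw <;> simp
  · rintro _ ⟨i, j, rfl⟩ _ ⟨i', j', rfl⟩ hne d d' hs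
    rcases sideSegment_eq_cases hs with ⟨rfl, hc⟩ | ⟨rfl, h1, -⟩
    · rw [center_eq_gridPoint, center_eq_gridPoint, gridPoint_inj] at hc
      obtain rfl : i' = i := by omega
      obtain rfl : j' = j := by omega
      exact absurd rfl hne
    · rw [corner_eq_gridPoint, corner_eq_gridPoint, gridPoint_inj] at h1
      have hpar : Even (j' - i') ↔ ¬ Even (j - i) := by
        have := h1.2
        revert this
        fin_cases d <;> simp [stepY] <;> grind
      have hd : (d + 2 = 1 ∨ d + 2 = 3) ↔ (d = 1 ∨ d = 3) := by clear * -; revert d; decide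
      intro he
      have e1 := hX.triangleColor_eq h i j d
      have e2 := hX.triangleColor_eq h i' j' (d + 2)
      dsimp only at he
      rw [← he, e1, hpar, hd] at e2
      tauto
  · rintro _ ⟨i, j, rfl⟩ d
    obtain ⟨k, c, e, hk⟩ := hl _ _ (even_of_corner i j d)
    refine ⟨k + 1, c, e, ?_⟩
    ext g
    rw [corner_eq_gridPoint, h.mem_crossing_iff o (even_of_corner i j d), mem_legalCrossing, hk,
      legalMarks_sub_one]

end SquareTiling

/-- There is a correct tiling of the plane by the decorated square tiles, and every correct tiling
is non-periodic. -/
theorem theorem1 :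
    (∃ T : Set SquareTiling.PlacedTile, SquareTiling.IsCorrectTiling T) ∧
      ∀ T : Set SquareTiling.PlacedTile, SquareTiling.IsCorrectTiling T →
        SquareTiling.IsNonPeriodic T := by
  obtain ⟨X, hX, hl⟩ := SquareTiling.exists_legal_grid
  obtain ⟨f, hf⟩ := hX.exists_shows
  exact ⟨⟨_, hX.isCorrectTiling hl hf 0⟩, fun T hT => hT.isNonPeriodic⟩
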